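/- Let $k\in\mathbb N$. A $k$-graph is a countable small category $\Lambda$ (identified with its set of morphisms, called paths, with range and source maps $r,s$, objects $\Lambda^0$ being identified with identity morphisms) together with a functor $d:\Lambda\to\mathbb N^k$ such that, whenever $d(\lambda)=m+n$, there are unique $\mu,\nu\in\Lambda$ with $\lambda=\mu\nu$, $d(\mu)=m$, $d(\nu)=n$. Assume that $\Lambda$ is finite ($\Lambda^n=\{\lambda: d(\lambda)=n\}$ is finite for every $n\in\mathbb N^k$) and source-free ($v\Lambda^n=\{\lambda\in\Lambda^n: r(\lambda)=v\}\neq\emptyset$ for all $v\in\Lambda^0$, $n\in\mathbb N^k$). Let $\Lambda^\infty$ be the space of infinite paths, i.e. of degree-preserving functors $x:\Omega_k\to\Lambda$, where $\Omega_k$ is the category with objects $\mathbb N^k$ and one morphism $(p,q)$ of range $p$, source $q$ and degree $q-p$ for each $p\le q$. Let $Z(\lambda)=\{x: x(0,d(\lambda))=\lambda\}$, equip $\Lambda^\infty$ with the topology generated by the sets $Z(\lambda)$ and its Borel $\sigma$-algebra, and let $\sigma^n(x)(p,q)=x(p+n,q+n)$. A representation of $C^*(\Lambda)$ on a complex Hilbert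 space $\mathcal H$ is a Cuntz--Krieger $\Lambda$-family of partial isometries $\{t_\lambda\}_{\lambda\in\Lambda}\subseteq B(\mathcal H)$: the $t_v$, $v\in\Lambda^0$, are mutually orthogonal projections; $t_\lambda t_\eta=t_{\lambda\eta}$ if $s(\lambda)=r(\eta)$; $t_\lambda^*t_\lambda=t_{s(\lambda)}$; and $t_v=\sum_{\lambda\in v\Lambda^n}t_\lambda t_\lambda^*$ for all $v\in\Lambda^0$, $n\in\mathbb N^k$. It is monic if $t_\lambda\ne0$ for all $\lambda$ and there is a cyclic vector, i.e. a $\xi\in\mathcal H$ with $\overline{\operatorname{span}}\{t_\lambda t_\lambda^*\xi:\lambda\in\Lambda\}=\mathcal H$. Given such a $\xi$, let $\mu$ be the unique Borel measure on $\Lambda^\infty$ with $\mu(Z(\lambda))=\langle\xi,t_\lambda t_\lambda^*\xi\rangle$ for all $\lambda$, let $W:L^2(\Lambda^\infty,\mu)\to\mathcal H$ be the unique unitary with $W(\chi_{Z(\lambda)})=t_\lambda t_\lambda^*\xi$ for all $\lambda$, and put $f_\lambda=W^*t_\lambda\xi\in L^2(\Lambda^\infty,\mu)$. Theorem. Let $\{S_\lambda\}_{\lambda\in\Lambda}$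 and $\{T_\lambda\}_{\lambda\in\Lambda}$ be two monic representations of $C^*(\Lambda)$ on Hilbert spaces $\mathcal H$ and $\mathcal K$, with arbitrary cyclic vectors $\xi\in\mathcal H$ and $\eta\in\mathcal K$, and let $\mu_S,f^S_\lambda$ and $\mu_T,f^T_\lambda$ be the associated measures and functions. Then the two representations are unitarily equivalent (there is a unitary $U:\mathcal H\to\mathcal K$ with $US_\lambda=T_\lambda U$ for all $\lambda\in\Lambda$) if and only if $\mu_S$ and $\mu_T$ are equivalent (mutually absolutely continuous) and there is a Borel function $h:\Lambda^\infty\to\mathbb C$ such that $$\frac{d\mu_S}{d\mu_T}=|h|^2\quad\text{almost everywhere, and}\qquad f^S_\lambda=\frac{h\circ\sigma^n}{h}\,f^T_\lambda\quad\text{almost everywhere}$$ for all $n\in\mathbb N^k$ and all $\lambda\in\Lambda$ with $d(\lambda)=n$. -/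

import Mathlib

open Set Filter MeasureTheory
open scoped ENNReal InnerProductSpace

universe u

/-- A `k`-graph: a countable small category, presented by its set `Obj` of objects (vertices),
its set `Mor` of morphisms (paths), range and source maps, identities and composition
(`comp l m` is the path `lm`, defined when `s l = r m`), with a degree functor to `ℕ^k`
having the unique factorization property. -/
structure KGraph (k : ℕ) where
  Obj : Type u
  Mor : Type u
  countable_mor : Countable Mor
  r : Mor → Obj
  s : Mor → Obj
  one : Obj → Mor
  comp : (l m : Mor) → s l = r m → Mor
  r_one : ∀ v, r (one v) = v
  s_one : ∀ v, s (one v) = v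
  r_comp : ∀ l m h, r (comp l m h) = r l
  s_comp : ∀ l m h, s (comp l m h) = s m
  one_comp : ∀ l (h : s (one (r l)) = r l), comp (one (r l)) l h = l
  comp_one : ∀ l (h : s l = r (one (s l))), comp l (one (s l)) h = l
  assoc : ∀ l m n (h₁ : s l = r m) (h₂ : s m = r n) (h₃ : s (comp l m h₁) = r n)
    (h₄ : s l = r (comp m n h₂)), comp (comp l m h₁) n h₃ = comp l (comp m n h₂) h₄
  deg : Mor → (Fin k → ℕ)
  deg_one : ∀ v, deg (one v) = 0
  deg_comp : ∀ l m h, deg (comp l m h) = deg l + deg m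
  factorization : ∀ (l : Mor) (m n : Fin k → ℕ), deg l = m + n →
    ∃! p : Mor × Mor, deg p.1 = m ∧ deg p.2 = n ∧ ∃ h : s p.1 = r p.2, comp p.1 p.2 h = l

namespace KGraph

variable {k : ℕ}

/-- `Λ` is finite: there are finitely many paths of each degree. -/
def IsFinite (Λ : KGraph.{u} k) : Prop :=
  ∀ n : Fin k → ℕ, {l : Λ.Mor | Λ.deg l = n}.Finite

/-- `Λ` is source-free: `vΛ^n` is nonempty for each vertex `v` and degree `n`. -/
def SourceFree (Λ : KGraph.{u} k) : Prop :=
  ∀ (v : Λ.Obj) (n : Fin k → ℕ), ∃ l : Λ.Mor, Λ.r l = v ∧ Λ.deg l = n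

/-- An infinite path: a degree-preserving functor `Ω_k → Λ`, where `Ω_k` has object set `ℕ^k`
and one morphism `(p, q)`, of range `p`, source `q` and degree `q - p`, for all `p ≤ q`. -/
@[ext]
structure InfinitePath (Λ : KGraph.{u} k) where
  obj : (Fin k → ℕ) → Λ.Obj
  map : (p q : Fin k → ℕ) → p ≤ q → Λ.Mor
  r_map : ∀ p q h, Λ.r (map p q h) = obj p
  s_map : ∀ p q h, Λ.s (map p q h) = obj q
  deg_map : ∀ p q h, Λ.deg (map p q h) = q - p
  map_one : ∀ p, map p p le_rfl = Λ.one (obj p)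
  map_comp : ∀ p q l (h₁ : p ≤ q) (h₂ : q ≤ l) (h : Λ.s (map p q h₁) = Λ.r (map q l h₂)),
    map p l (h₁.trans h₂) = Λ.comp (map p q h₁) (map q l h₂) h

namespace InfinitePath

variable {Λ : KGraph.{u} k}

/-- The shift map `σ^m`, `σ^m(x)(p, q) = x(p + m, q + m)`. -/
def shift (m : Fin k → ℕ) (x : Λ.InfinitePath) : Λ.InfinitePath where
  obj p := x.obj (p + m)
  map p q h := x.map (p + m) (q + m) (add_le_add_left h m)
  r_map _ _ _ := x.r_map _ _ _
  s_map _ _ _ := x.s_map _ _ _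
  deg_map p q _ := by rw [x.deg_map, add_tsub_add_eq_tsub_right]
  map_one _ := x.map_one _
  map_comp _ _ _ _ _ h := x.map_comp _ _ _ _ _ h

/-- The initial segment `x(0, n)`. -/
def seg (x : Λ.InfinitePath) (n : Fin k → ℕ) : Λ.Mor := x.map 0 n zero_le

end InfinitePath

/-- The cylinder set `Z(l) = {x : x(0, d(l)) = l}`. -/
def cyl (Λ : KGraph.{u} k) (l : Λ.Mor) : Set Λ.InfinitePath := {x | x.seg (Λ.deg l) = l}

/-- The topology on the infinite path space generated by the cylinder sets. -/
instance (Λ : KGraph.{u} k) : TopologicalSpace Λ.InfinitePath :=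
  TopologicalSpace.generateFrom (range Λ.cyl)

/-- The Borel σ-algebra of the infinite path space. -/
instance (Λ : KGraph.{u} k) : MeasurableSpace Λ.InfinitePath := borel _

instance (Λ : KGraph.{u} k) : BorelSpace Λ.InfinitePath := ⟨rfl⟩

/-- A representation of `C*(Λ)` on the Hilbert space `H`, given by its generators: a
Cuntz–Krieger `Λ`-family of partial isometries `t l` in `B(H)`. It is meant for finite `Λ`, where
the sum in `ck4` is over a finite set. -/
structure CKFamily (Λ : KGraph.{u} k) (H : Type*) [NormedAddCommGroup H] [InnerProductSpace ℂ H]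
    [CompleteSpace H] where
  t : Λ.Mor → H →L[ℂ] H
  partialIsometry : ∀ l, t l * star (t l) * t l = t l
  ck1_proj : ∀ v, IsStarProjection (t (Λ.one v))
  ck1_orth : ∀ v w, v ≠ w → t (Λ.one v) * t (Λ.one w) = 0
  ck2 : ∀ l m (h : Λ.s l = Λ.r m), t l * t m = t (Λ.comp l m h)
  ck3 : ∀ l, star (t l) * t l = t (Λ.one (Λ.s l))
  ck4 : ∀ (v : Λ.Obj) (n : Fin k → ℕ),
    t (Λ.one v) = ∑ᶠ l ∈ {l : Λ.Mor | Λ.r l = v ∧ Λ.deg l = n}, t l * star (t l)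

/-! ### Combinatorics of paths -/

section Paths

variable {Λ : KGraph.{u} k}

theorem factor_unique {a b c d : Λ.Mor} (h : Λ.s a = Λ.r b) (h' : Λ.s c = Λ.r d)
    (e : Λ.comp a b h = Λ.comp c d h') (hd : Λ.deg a = Λ.deg c) : a = c ∧ b = d := by
  have h1 : Λ.deg a + Λ.deg b = Λ.deg c + Λ.deg d := by
    rw [← Λ.deg_comp a b h, ← Λ.deg_comp c d h', e]
  have h2 : Λ.deg b = Λ.deg d := by
    rw [hd] at h1
    exact add_left_cancel h1
  have := (Λ.factorization (Λ.comp a b h) (Λ.deg a) (Λ.deg b) (Λ.deg_comp _ _ _)).unique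
    (y₁ := (a, b)) (y₂ := (c, d)) ⟨rfl, rfl, h, rfl⟩ ⟨hd.symm, h2.symm, h', e.symm⟩
  exact Prod.ext_iff.1 this

theorem eq_one_of_deg_zero {l : Λ.Mor} (h : Λ.deg l = 0) : Λ.one (Λ.r l) = l := by
  have e : Λ.comp (Λ.one (Λ.r l)) l (Λ.s_one _) = Λ.comp l (Λ.one (Λ.s l)) (Λ.r_one _).symm := by
    rw [Λ.one_comp, Λ.comp_one]
  exact (factor_unique _ _ e (by rw [Λ.deg_one, h])).1

/-- `a` is an initial segment of `b`. -/
def Pre (a b : Λ.Mor) : Prop := ∃ c, ∃ h : Λ.s a = Λ.r c, b = Λ.comp a c h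

theorem Pre.r_eq {a b : Λ.Mor} (h : Pre a b) : Λ.r b = Λ.r a := by
  obtain ⟨c, h, rfl⟩ := h
  exact Λ.r_comp _ _ _

theorem Pre.trans {a b c : Λ.Mor} (h : Pre a b) (h' : Pre b c) : Pre a c := by
  obtain ⟨d, h, rfl⟩ := h
  obtain ⟨e, h', rfl⟩ := h'
  have h2 : Λ.s d = Λ.r e := by rw [← h', Λ.s_comp]
  exact ⟨Λ.comp d e h2, by rw [Λ.r_comp, h], Λ.assoc _ _ _ _ _ _ _⟩

theorem Pre.eq {a b c : Λ.Mor} (h : Pre a c) (h' : Pre b c) (hd : Λ.deg a = Λ.deg b) : a = b := by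
  obtain ⟨d, h, rfl⟩ := h
  obtain ⟨e, h', e'⟩ := h'
  exact (factor_unique _ _ e' hd).1

theorem exists_pre (b : Λ.Mor) {n : Fin k → ℕ} (h : n ≤ Λ.deg b) :
    ∃ a, Λ.deg a = n ∧ Pre a b := by
  obtain ⟨⟨p, q⟩, ⟨h1, -, h3, h4⟩, -⟩ :=
    Λ.factorization b n (Λ.deg b - n) (add_tsub_cancel_of_le h).symm
  exact ⟨p, h1, q, h3, h4.symm⟩

theorem Pre.of_le {a b c : Λ.Mor} (h : Pre a c) (h' : Pre b c) (hd : Λ.deg a ≤ Λ.deg b) :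
    Pre a b := by
  obtain ⟨a', e, ha'⟩ := exists_pre b hd
  rwa [h.eq (ha'.trans h') e.symm]

theorem Pre.refl (a : Λ.Mor) : Pre a a :=
  ⟨Λ.one (Λ.s a), (Λ.r_one _).symm, (Λ.comp_one a (Λ.r_one _).symm).symm⟩

theorem exists_ext (hs : Λ.SourceFree) (a : Λ.Mor) {n : Fin k → ℕ} (h : Λ.deg a ≤ n) :
    ∃ b, Λ.deg b = n ∧ Pre a b := by
  obtain ⟨c, h1, h2⟩ := hs (Λ.s a) (n - Λ.deg a)
  exact ⟨Λ.comp a c h1.symm, by rw [Λ.deg_comp, h2, add_tsub_cancel_of_le h], c, h1.symm, rfl⟩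

namespace InfinitePath

theorem deg_seg (x : Λ.InfinitePath) (n : Fin k → ℕ) : Λ.deg (x.seg n) = n := by
  simp [seg, x.deg_map]

theorem pre_seg (x : Λ.InfinitePath) {m n : Fin k → ℕ} (h : m ≤ n) : Pre (x.seg m) (x.seg n) :=
  ⟨x.map m n h, by rw [seg, x.s_map, x.r_map], x.map_comp _ _ _ _ _ _⟩

/-- A compatible family of finite paths is the family of initial segments of an infinite path. -/
theorem exists_of_compatible (y : (Fin k → ℕ) → Λ.Mor) (hd : ∀ n, Λ.deg (y n) = n)
    (hy : ∀ m n, m ≤ n → Pre (y m) (y n)) : ∃ x : Λ.InfinitePath, ∀ n, x.seg n = y n := by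
  choose z hz e using hy
  have hs : ∀ p q h, Λ.s (z p q h) = Λ.s (y q) := fun p q h => by
    conv_rhs => rw [e p q h, Λ.s_comp]
  refine ⟨⟨fun p => Λ.s (y p), z, fun p q h => (hz p q h).symm, hs, ?_, ?_, ?_⟩, ?_⟩
  · intro p q h
    have := congrArg Λ.deg (e p q h)
    rw [Λ.deg_comp, hd, hd] at this
    exact (tsub_eq_of_eq_add_rev this).symm
  · intro p
    have h1 : Λ.comp (y p) (z p p le_rfl) (hz _ _ _)
        = Λ.comp (y p) (Λ.one (Λ.s (y p))) (Λ.r_one _).symm := by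
      rw [← e, Λ.comp_one]
    exact (factor_unique _ _ h1 rfl).2
  · intro p q l h₁ h₂ h
    have h3 : Λ.s (y p) = Λ.r (Λ.comp (z p q h₁) (z q l h₂) h) := by rw [Λ.r_comp, hz]
    have h4 : Λ.s (Λ.comp (y p) (z p q h₁) (hz _ _ _)) = Λ.r (z q l h₂) := by rw [Λ.s_comp, h]
    have h1 : Λ.comp (y p) (z p l (h₁.trans h₂)) (hz _ _ _) = Λ.comp (y p) _ h3 := by
      rw [← e, ← Λ.assoc _ _ _ (hz _ _ _) h h4]
      conv_lhs => rw [e q l h₂]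
      congr 1
      exact e p q h₁
    exact (factor_unique _ _ h1 rfl).2
  · intro n
    have h0 := eq_one_of_deg_zero (hd 0)
    have h1 : Λ.s (y 0) = Λ.r (y 0) := by
      conv_lhs => rw [← h0, Λ.s_one]
    have h2 : Λ.r (z 0 n zero_le) = Λ.r (y 0) := by rw [← hz, h1]
    have h3 := e 0 n zero_le
    have h4 : Λ.comp (y 0) (z 0 n zero_le) (hz _ _ _) = z 0 n zero_le := by
      have h5 := Λ.one_comp (z 0 n zero_le) (Λ.s_one _)
      conv_rhs => rw [← h5]
      congr 1
      rw [h2, h0]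
    change z 0 n zero_le = y n
    rw [← h4, ← h3]

theorem ext_seg {x y : Λ.InfinitePath} (h : ∀ n, x.seg n = y.seg n) : x = y := by
  have hm : ∀ p q hpq, x.map p q hpq = y.map p q hpq := by
    intro p q hpq
    have h1 := x.map_comp 0 p q zero_le hpq (by rw [x.s_map, x.r_map])
    have h2 := y.map_comp 0 p q zero_le hpq (by rw [y.s_map, y.r_map])
    have h3 : x.map 0 q zero_le = y.map 0 q zero_le := h q
    rw [h1, h2] at h3
    exact (factor_unique _ _ h3 (by rw [x.deg_map, y.deg_map])).2
  refine InfinitePath.ext ?_ ?_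
  · funext p
    rw [← x.r_map p p le_rfl, hm, y.r_map]
  · funext p q hpq
    exact hm p q hpq

end InfinitePath

theorem mem_cyl_iff {x : Λ.InfinitePath} {l : Λ.Mor} {n : Fin k → ℕ} (h : Λ.deg l ≤ n) :
    x ∈ Λ.cyl l ↔ Pre l (x.seg n) := by
  constructor
  · intro hx
    have := x.pre_seg h
    rwa [show x.seg (Λ.deg l) = l from hx] at this
  · intro hx
    exact (x.pre_seg h).eq hx (x.deg_seg _)

theorem level_finite (hf : Λ.IsFinite) (n : Fin k → ℕ) : Finite {l : Λ.Mor // Λ.deg l = n} :=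
  (hf n).to_subtype

theorem isOpen_cyl (l : Λ.Mor) : IsOpen (Λ.cyl l) :=
  TopologicalSpace.isOpen_generateFrom_of_mem ⟨l, rfl⟩

theorem isClosed_coord {ι : Type*} {X : ι → Type*} [∀ i, TopologicalSpace (X i)]
    [∀ i, DiscreteTopology (X i)] (i : ι) (p : X i → Prop) : IsClosed {y : (i : ι) → X i | p (y i)} :=
  (isClosed_discrete {a | p a}).preimage (f := fun y : (i : ι) → X i => y i) (continuous_apply i)

theorem isClosed_coord₂ {ι : Type*} {X : ι → Type*} [∀ i, TopologicalSpace (X i)]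
    [∀ i, DiscreteTopology (X i)] (i j : ι) (p : X i → X j → Prop) :
    IsClosed {y : (i : ι) → X i | p (y i) (y j)} :=
  (isClosed_discrete {a : X i × X j | p a.1 a.2}).preimage
    (f := fun y : (i : ι) → X i => (y i, y j)) ((continuous_apply i).prodMk (continuous_apply j))

theorem exists_mem_cyl (hf : Λ.IsFinite) (hs : Λ.SourceFree) (l : Λ.Mor) :
    ∃ x : Λ.InfinitePath, x ∈ Λ.cyl l := by
  classical
  let : ∀ n : Fin k → ℕ, TopologicalSpace {l : Λ.Mor // Λ.deg l = n} := fun _ => ⊥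
  have : ∀ n : Fin k → ℕ, DiscreteTopology {l : Λ.Mor // Λ.deg l = n} := fun _ => ⟨rfl⟩
  have := level_finite hf
  let K : {N : Fin k → ℕ // Λ.deg l ≤ N} → Set ((n : Fin k → ℕ) → {l : Λ.Mor // Λ.deg l = n}) :=
    fun N => {y | Pre l (y N).1 ∧ ∀ m, m ≤ N.1 → Pre (y m).1 (y N).1}
  have hcl : ∀ N, IsClosed (K N) := by
    intro N
    simp only [K, ofPred_and, ofPred_forall]
    exact (isClosed_coord (X := fun n => {l : Λ.Mor // Λ.deg l = n}) N.1 fun a => Pre l a.1).inter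
      (isClosed_iInter fun m => isClosed_iInter fun _ => isClosed_coord₂
        (X := fun n => {l : Λ.Mor // Λ.deg l = n}) m N.1 fun a b => Pre a.1 b.1)
  have hne : ∀ N, (K N).Nonempty := by
    intro N
    obtain ⟨b, hb, hlb⟩ := exists_ext hs l N.2
    have : ∀ m, ∃ a : {l : Λ.Mor // Λ.deg l = m}, m ≤ N.1 → Pre a.1 b := by
      intro m
      by_cases h : m ≤ N.1
      · obtain ⟨a, ha, h'⟩ := exists_pre b (h.trans hb.ge)
        exact ⟨⟨a, ha⟩, fun _ => h'⟩
      · obtain ⟨a, -, ha⟩ := hs (Λ.r l) m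
        exact ⟨⟨a, ha⟩, fun h' => absurd h' h⟩
    choose y hy using this
    have hyN : (y N.1).1 = b := (hy N.1 le_rfl).eq (Pre.refl b) (by rw [(y N.1).2, hb])
    exact ⟨y, by rw [hyN]; exact hlb, fun m hm => by rw [hyN]; exact hy m hm⟩
  have hdir : Directed (fun x1 x2 => x1 ⊇ x2) K := by
    have key : ∀ M N : {N : Fin k → ℕ // Λ.deg l ≤ N}, M.1 ≤ N.1 → K N ⊆ K M := by
      intro M N h y hy
      refine ⟨hy.1.of_le (hy.2 M.1 h) (by rw [(y M.1).2]; exact M.2), fun m hm => ?_⟩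
      exact (hy.2 m (hm.trans h)).of_le (hy.2 M.1 h) (by rw [(y m).2, (y M.1).2]; exact hm)
    intro M N
    exact ⟨⟨M.1 ⊔ N.1, M.2.trans le_sup_left⟩, key _ _ le_sup_left, key _ _ le_sup_right⟩
  have : Nonempty {N : Fin k → ℕ // Λ.deg l ≤ N} := ⟨⟨_, le_rfl⟩⟩
  obtain ⟨y, hy⟩ := IsCompact.nonempty_iInter_of_directed_nonempty_isCompact_isClosed K hdir hne
    (fun N => (hcl N).isCompact) hcl
  rw [mem_iInter] at hy
  obtain ⟨x, hx⟩ := InfinitePath.exists_of_compatible (fun n => (y n).1) (fun n => (y n).2)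
    (fun m n h => by
      have h1 := hy ⟨Λ.deg l ⊔ n, le_sup_left⟩
      exact (h1.2 m (h.trans le_sup_right)).of_le (h1.2 n le_sup_right)
        (by rw [(y m).2, (y n).2]; exact h))
  refine ⟨x, (mem_cyl_iff le_rfl).2 ?_⟩
  rw [hx]
  exact (hy ⟨Λ.deg l, le_rfl⟩).1

theorem compactSpace (hf : Λ.IsFinite) : CompactSpace Λ.InfinitePath := by
  let : ∀ n : Fin k → ℕ, TopologicalSpace {l : Λ.Mor // Λ.deg l = n} := fun _ => ⊥
  have : ∀ n : Fin k → ℕ, DiscreteTopology {l : Λ.Mor // Λ.deg l = n} := fun _ => ⟨rfl⟩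
  have := level_finite hf
  let e : Λ.InfinitePath → ((n : Fin k → ℕ) → {l : Λ.Mor // Λ.deg l = n}) :=
    fun x n => ⟨x.seg n, x.deg_seg n⟩
  have hind : Topology.IsInducing e := by
    refine ⟨le_antisymm ?_ ?_⟩
    · refine continuous_iff_le_induced.1 (continuous_pi fun n => ?_)
      refine continuous_discrete_rng.2 fun a => ?_
      convert isOpen_cyl a.1 using 1
      ext x
      simp only [e, cyl, mem_preimage, mem_singleton_iff, mem_ofPred_eq, a.2, Subtype.ext_iff]
    · refine le_generateFrom ?_
      rintro _ ⟨l, rfl⟩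
      refine isOpen_induced_iff.2 ⟨{y | y (Λ.deg l) = ⟨l, rfl⟩}, ?_, ?_⟩
      · rw [← isClosed_compl_iff]
        exact isClosed_coord (X := fun n => {l : Λ.Mor // Λ.deg l = n}) (Λ.deg l)
          fun a => ¬ a = ⟨l, rfl⟩
      · ext x
        simp only [e, cyl, mem_preimage, mem_ofPred_eq, Subtype.ext_iff]
  have hr : range e = {y | ∀ m n, m ≤ n → Pre (y m).1 (y n).1} := by
    ext y
    constructor
    · rintro ⟨x, rfl⟩ m n h
      exact x.pre_seg h
    · intro hy
      obtain ⟨x, hx⟩ := InfinitePath.exists_of_compatible (fun n => (y n).1) (fun n => (y n).2) hy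
      exact ⟨x, funext fun n => Subtype.ext (hx n)⟩
  refine ⟨hind.isCompact_iff.2 ?_⟩
  rw [image_univ, hr]
  refine IsClosed.isCompact ?_
  simp only [ofPred_forall]
  refine isClosed_iInter fun m => isClosed_iInter fun n => isClosed_iInter fun _ => ?_
  exact isClosed_coord₂ (X := fun n => {l : Λ.Mor // Λ.deg l = n}) m n fun a b => Pre a.1 b.1

theorem borel_eq :
    (inferInstance : MeasurableSpace Λ.InfinitePath)
      = MeasurableSpace.generateFrom (range Λ.cyl) := by
  have := Λ.countable_mor
  have : SecondCountableTopology Λ.InfinitePath := ⟨⟨range Λ.cyl, countable_range _, rfl⟩⟩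
  exact borel_eq_generateFrom_of_subbasis rfl

theorem measurableSet_cyl (l : Λ.Mor) : MeasurableSet (Λ.cyl l) := (isOpen_cyl l).measurableSet

variable (Λ) in
/-- The sets of infinite paths that are determined by some initial segment. -/
def LevelSets : Set (Set Λ.InfinitePath) :=
  {A | ∃ n, ∀ x y : Λ.InfinitePath, x.seg n = y.seg n → (x ∈ A ↔ y ∈ A)}

theorem seg_eq_of_le {x y : Λ.InfinitePath} {m n : Fin k → ℕ} (h : m ≤ n)
    (e : x.seg n = y.seg n) : x.seg m = y.seg m :=
  (x.pre_seg h).eq (e ▸ y.pre_seg h) (by rw [x.deg_seg, y.deg_seg])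

theorem cyl_mem_levelSets (l : Λ.Mor) : Λ.cyl l ∈ Λ.LevelSets :=
  ⟨Λ.deg l, fun x y h => by simp only [cyl, mem_ofPred_eq, h]⟩

theorem isSetRing_levelSets : IsSetRing Λ.LevelSets where
  empty_mem := ⟨0, fun _ _ _ => Iff.rfl⟩
  union_mem := by
    rintro A B ⟨m, hm⟩ ⟨n, hn⟩
    exact ⟨m ⊔ n, fun x y h => or_congr (hm x y (seg_eq_of_le le_sup_left h))
      (hn x y (seg_eq_of_le le_sup_right h))⟩
  sdiff_mem := by
    rintro A B ⟨m, hm⟩ ⟨n, hn⟩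
    exact ⟨m ⊔ n, fun x y h => and_congr (hm x y (seg_eq_of_le le_sup_left h))
      (not_congr (hn x y (seg_eq_of_le le_sup_right h)))⟩

theorem compl_mem_levelSets {A : Set Λ.InfinitePath} (h : A ∈ Λ.LevelSets) :
    Aᶜ ∈ Λ.LevelSets := by
  obtain ⟨n, hn⟩ := h
  exact ⟨n, fun x y h => not_congr (hn x y h)⟩

theorem isOpen_of_mem_levelSets {A : Set Λ.InfinitePath} (h : A ∈ Λ.LevelSets) : IsOpen A := by
  obtain ⟨n, hn⟩ := h
  rw [isOpen_iff_forall_mem_open]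
  intro x hx
  refine ⟨Λ.cyl (x.seg n), fun y hy => (hn x y ?_).1 hx, isOpen_cyl _, ?_⟩
  · simp only [cyl, mem_ofPred_eq, x.deg_seg] at hy
    exact hy.symm
  · simp only [cyl, mem_ofPred_eq, x.deg_seg]

theorem borel_eq_levelSets :
    (inferInstance : MeasurableSpace Λ.InfinitePath)
      = MeasurableSpace.generateFrom Λ.LevelSets := by
  refine le_antisymm ?_ ?_
  · rw [borel_eq]
    refine MeasurableSpace.generateFrom_mono ?_
    rintro _ ⟨l, rfl⟩
    exact cyl_mem_levelSets l
  · exact MeasurableSpace.generateFrom_le fun A hA => (isOpen_of_mem_levelSets hA).measurableSet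

end Paths

/-! ### The measure and the functions associated to a monic representation -/

namespace CKFamily

variable {Λ : KGraph.{u} k} {H : Type*} [NormedAddCommGroup H] [InnerProductSpace ℂ H]
  [CompleteSpace H]

/-- The range projection `t_l t_l^*`. -/
noncomputable def proj (S : Λ.CKFamily H) (l : Λ.Mor) : H →L[ℂ] H := S.t l * star (S.t l)

theorem isStarProjection_proj (S : Λ.CKFamily H) (l : Λ.Mor) : IsStarProjection (S.proj l) where
  isIdempotentElem := by
    change S.t l * star (S.t l) * (S.t l * star (S.t l)) = _
    rw [← mul_assoc, S.partialIsometry]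
    rfl
  isSelfAdjoint := IsSelfAdjoint.mul_star_self _

theorem inner_proj_left (S : Λ.CKFamily H) (l : Λ.Mor) (x y : H) :
    ⟪S.proj l x, y⟫_ℂ = ⟪x, S.proj l y⟫_ℂ := by
  have h : star (S.proj l) = S.proj l := (S.isStarProjection_proj l).isSelfAdjoint
  conv_lhs => rw [← h]
  exact ContinuousLinearMap.adjoint_inner_left _ _ _

theorem proj_proj (S : Λ.CKFamily H) (l : Λ.Mor) (x : H) : S.proj l (S.proj l x) = S.proj l x :=
  DFunLike.congr_fun (S.isStarProjection_proj l).isIdempotentElem x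

theorem inner_proj_self (S : Λ.CKFamily H) (l : Λ.Mor) (x : H) :
    ⟪x, S.proj l x⟫_ℂ = ((‖S.proj l x‖ ^ 2 : ℝ) : ℂ) := by
  rw [← S.proj_proj, ← S.inner_proj_left, S.proj_proj, inner_self_eq_norm_sq_to_K]
  norm_cast

/-- The paths of degree `n` that extend `l`. -/
noncomputable def exts (hf : Λ.IsFinite) (l : Λ.Mor) (n : Fin k → ℕ) : Finset Λ.Mor :=
  haveI : DecidablePred (Pre l) := Classical.decPred _
  (hf n).toFinset.filter (Pre l)

theorem mem_exts {hf : Λ.IsFinite} {l m : Λ.Mor} {n : Fin k → ℕ} :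
    m ∈ exts hf l n ↔ Λ.deg m = n ∧ Pre l m := by
  simp [exts]

theorem one_mul_t (S : Λ.CKFamily H) (l : Λ.Mor) : S.t (Λ.one (Λ.r l)) * S.t l = S.t l := by
  rw [S.ck2 _ _ (Λ.s_one _), Λ.one_comp]

theorem t_mul_one (S : Λ.CKFamily H) (l : Λ.Mor) : S.t l * S.t (Λ.one (Λ.s l)) = S.t l := by
  rw [S.ck2 _ _ (Λ.r_one _).symm, Λ.comp_one]

theorem one_eq_sum (S : Λ.CKFamily H) (hf : Λ.IsFinite) (v : Λ.Obj) (n : Fin k → ℕ) :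
    S.t (Λ.one v) = ∑ l ∈ ((hf n).inter_of_right {l | Λ.r l = v}).toFinset, S.proj l := by
  rw [S.ck4 v n]
  exact finsum_mem_eq_finite_toFinset_sum _ ((hf n).inter_of_right {l | Λ.r l = v})

theorem proj_eq_sum (S : Λ.CKFamily H) (hf : Λ.IsFinite) (l : Λ.Mor) {n : Fin k → ℕ}
    (h : Λ.deg l ≤ n) : S.proj l = ∑ m ∈ exts hf l n, S.proj m := by
  have h1 : S.proj l = S.t l * S.t (Λ.one (Λ.s l)) * star (S.t l) := by rw [S.t_mul_one]; rfl
  rw [h1, S.one_eq_sum hf _ (n - Λ.deg l), Finset.mul_sum, Finset.sum_mul]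
  refine Finset.sum_bij (fun m hm => Λ.comp l m ?_) ?_ ?_ ?_ ?_
  · simp only [Finite.mem_toFinset] at hm
    exact hm.1.symm
  · intro m hm
    simp only [Finite.mem_toFinset] at hm
    refine mem_exts.2 ⟨?_, m, hm.1.symm, rfl⟩
    rw [Λ.deg_comp, show Λ.deg m = _ from hm.2, add_tsub_cancel_of_le h]
  · intro a ha b hb e
    exact (factor_unique _ _ e rfl).2
  · intro b hb
    obtain ⟨h2, c, h3, rfl⟩ := mem_exts.1 hb
    refine ⟨c, ?_, rfl⟩
    simp only [Finite.mem_toFinset]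
    refine ⟨h3.symm, ?_⟩
    change Λ.deg c = _
    rw [← h2, Λ.deg_comp, add_tsub_cancel_left]
  · intro m hm
    simp only [Finite.mem_toFinset] at hm
    rw [proj, proj, ← S.ck2 l m hm.1.symm, star_mul, mul_assoc, mul_assoc, mul_assoc]

theorem proj_proj_of_ne (S : Λ.CKFamily H) (hf : Λ.IsFinite) {l m : Λ.Mor}
    (hd : Λ.deg l = Λ.deg m) (hne : l ≠ m) (x : H) : S.proj l (S.proj m x) = 0 := by
  classical
  by_cases hr : Λ.r l = Λ.r m
  · set y := S.proj m x with hy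
    set F := ((hf (Λ.deg m)).inter_of_right {l | Λ.r l = Λ.r m}).toFinset with hF
    have h1 : S.t (Λ.one (Λ.r m)) y = y := by
      have : S.t (Λ.one (Λ.r m)) * S.proj m = S.proj m := by
        rw [proj, ← mul_assoc, S.one_mul_t]
      exact DFunLike.congr_fun this x
    rw [S.one_eq_sum hf _ (Λ.deg m), sum_apply] at h1
    have h2 : ∑ i ∈ F, ‖S.proj i y‖ ^ 2 = ‖y‖ ^ 2 := by
      have h3 : ⟪y, ∑ i ∈ F, S.proj i y⟫_ℂ = ⟪y, y⟫_ℂ := by rw [h1]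
      rw [inner_sum, Finset.sum_congr rfl fun i _ => S.inner_proj_self i y,
        inner_self_eq_norm_sq_to_K, ← Complex.ofReal_sum] at h3
      exact Complex.ofReal_injective (h3.trans (Complex.ofReal_pow _ _).symm)
    have hm : m ∈ F := by simp [hF]
    have hl : l ∈ F.erase m := by simp [hF, hne, hr, hd]
    rw [← Finset.add_sum_erase _ _ hm, hy, S.proj_proj, ← hy] at h2
    have h4 := (Finset.sum_eq_zero_iff_of_nonneg (fun i _ => sq_nonneg ‖S.proj i y‖)).1
      (add_eq_left.1 h2) l hl
    simpa using h4
  · have h1 : star (S.t l) * S.t m = 0 := by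
      rw [← S.one_mul_t l, ← S.one_mul_t m, star_mul, (S.ck1_proj _).isSelfAdjoint.star_eq,
        mul_assoc, ← mul_assoc (S.t (Λ.one (Λ.r l))), S.ck1_orth _ _ hr]
      simp
    have h2 : S.proj l * S.proj m = 0 := by
      rw [proj, proj, mul_assoc, ← mul_assoc (star (S.t l)), h1]
      simp
    exact DFunLike.congr_fun h2 x

theorem inner_proj_proj (S : Λ.CKFamily H) (hf : Λ.IsFinite) (ξ : H) (l m : Λ.Mor)
    [DecidableEq Λ.Mor] :
    ⟪S.proj l ξ, S.proj m ξ⟫_ℂ = ((∑ i ∈ exts hf l (Λ.deg l ⊔ Λ.deg m) ∩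
      exts hf m (Λ.deg l ⊔ Λ.deg m), ‖S.proj i ξ‖ ^ 2 : ℝ) : ℂ) := by
  rw [S.proj_eq_sum hf l le_sup_left, S.proj_eq_sum hf m le_sup_right,
    sum_apply, sum_apply, sum_inner]
  have : ∀ i ∈ exts hf l (Λ.deg l ⊔ Λ.deg m),
      ⟪S.proj i ξ, ∑ j ∈ exts hf m (Λ.deg l ⊔ Λ.deg m), S.proj j ξ⟫_ℂ =
      if i ∈ exts hf m (Λ.deg l ⊔ Λ.deg m) then ((‖S.proj i ξ‖ ^ 2 : ℝ) : ℂ) else 0 := by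
    intro i hi
    rw [inner_sum, ← Finset.sum_ite_eq' (exts hf m (Λ.deg l ⊔ Λ.deg m)) i
      (fun j => ((‖S.proj j ξ‖ ^ 2 : ℝ) : ℂ))]
    refine Finset.sum_congr rfl fun j hj => ?_
    rw [S.inner_proj_left]
    split_ifs with h
    · rw [h, S.proj_proj, S.inner_proj_self]
    · rw [S.proj_proj_of_ne hf _ (Ne.symm h), inner_zero_right]
      rw [(mem_exts.1 hi).1, (mem_exts.1 hj).1]
  rw [Finset.sum_congr rfl this, ← Finset.sum_filter, Finset.filter_mem_eq_inter]
  push_cast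
  rfl

/-- The weight `⟨ξ, t_l t_l^* ξ⟩` (a nonnegative real number) of the cylinder `Z(l)`. -/
noncomputable def weight (S : Λ.CKFamily H) (ξ : H) (l : Λ.Mor) : ℝ≥0∞ :=
  ENNReal.ofReal (RCLike.re ⟪ξ, S.t l (star (S.t l) ξ)⟫_ℂ)

theorem weight_eq (S : Λ.CKFamily H) (ξ : H) (l : Λ.Mor) :
    S.weight ξ l = ENNReal.ofReal (‖S.proj l ξ‖ ^ 2) := by
  rw [weight, show S.t l (star (S.t l) ξ) = S.proj l ξ from rfl, S.inner_proj_self]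
  rfl

theorem weight_eq_sum (S : Λ.CKFamily H) (hf : Λ.IsFinite) (ξ : H) (l : Λ.Mor) {n : Fin k → ℕ}
    (h : Λ.deg l ≤ n) : S.weight ξ l = ∑ m ∈ exts hf l n, S.weight ξ m := by
  have h1 : ⟪ξ, S.proj l ξ⟫_ℂ = ∑ m ∈ exts hf l n, ⟪ξ, S.proj m ξ⟫_ℂ := by
    rw [S.proj_eq_sum hf l h, sum_apply, inner_sum]
  simp only [inner_proj_self] at h1
  rw [weight_eq, Finset.sum_congr rfl fun m _ => S.weight_eq ξ m,
    ← ENNReal.ofReal_sum_of_nonneg (fun _ _ => sq_nonneg _)]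
  congr 1
  exact_mod_cast h1

/-- Existence of the Borel measure `μ` on the infinite path space with
`μ(Z(l)) = ⟨ξ, t_l t_l^* ξ⟩` for all `l`. -/
theorem exists_measure (S : Λ.CKFamily H) (hf : Λ.IsFinite) (hs : Λ.SourceFree) (ξ : H) :
    ∃ μ : Measure Λ.InfinitePath, ∀ l, μ (Λ.cyl l) = S.weight ξ l := by
  classical
  choose x hx using exists_mem_cyl hf hs
  have hxs : ∀ l, (x l).seg (Λ.deg l) = l := hx
  let a : (Fin k → ℕ) → Set Λ.InfinitePath → ℝ≥0∞ := fun n A =>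
    ∑ l ∈ (hf n).toFinset, if x l ∈ A then S.weight ξ l else 0
  have hstab : ∀ A : Set Λ.InfinitePath, ∀ n, (∀ x y : Λ.InfinitePath, x.seg n = y.seg n →
      (x ∈ A ↔ y ∈ A)) → ∀ N, n ≤ N → a N A = a n A := by
    intro A n hA N hN
    have h1 : ∀ l ∈ (hf n).toFinset, (if x l ∈ A then S.weight ξ l else 0) =
        ∑ m ∈ (hf N).toFinset with (x m).seg n = l, if x m ∈ A then S.weight ξ m else 0 := by
      intro l hl
      have hl : Λ.deg l = n := by simpa using hl
      have h2 : (hf N).toFinset.filter (fun m => (x m).seg n = l) = exts hf l N := by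
        ext m
        simp only [Finset.mem_filter, Finite.mem_toFinset, mem_ofPred_eq, mem_exts,
          and_congr_right_iff]
        intro hm
        have := mem_cyl_iff (x := x m) (l := l) (n := N) (hl.trans_le hN)
        rw [← hm, hxs] at this
        rw [← this, ← hl]
        rfl
      rw [h2]
      have h3 : ∀ m ∈ exts hf l N, (x m ∈ A ↔ x l ∈ A) := by
        intro m hm
        rw [← h2, Finset.mem_filter] at hm
        refine hA _ _ (hm.2.trans ?_)
        rw [← hl, hxs]
      rw [Finset.sum_congr rfl fun m hm => by rw [if_congr (h3 m hm) rfl rfl]]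
      split_ifs
      · exact S.weight_eq_sum hf ξ l (hl.trans_le hN)
      · simp
    rw [show a n A = _ from Finset.sum_congr rfl h1]
    exact (Finset.sum_fiberwise_of_maps_to (s := (hf N).toFinset) (t := (hf n).toFinset)
      (g := fun m => (x m).seg n) (fun m _ => by simp [(x m).deg_seg]) _).symm
  let m₀ : Set Λ.InfinitePath → ℝ≥0∞ := fun A => liminf (fun n => a n A) atTop
  have hev : ∀ A ∈ Λ.LevelSets, ∀ᶠ n in atTop, a n A = m₀ A := by
    rintro A ⟨n, hn⟩
    have h1 : ∀ᶠ N in atTop, a N A = a n A := (eventually_ge_atTop n).mono fun N hN =>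
      hstab A n hn N hN
    have h2 : m₀ A = a n A := (tendsto_const_nhds.congr' (h1.mono fun _ h => h.symm)).liminf_eq
    rw [h2]
    exact h1
  let m : AddContent ℝ≥0∞ Λ.LevelSets := isSetRing_levelSets.addContent_of_union m₀
    (by
      obtain ⟨n, hn⟩ := (hev ∅ isSetRing_levelSets.empty_mem).exists
      rw [← hn]
      simp [a])
    (by
      intro A B hA hB hAB
      obtain ⟨n, ⟨h1, h2⟩, h3⟩ := ((hev A hA).and (hev B hB)).and
        (hev _ (isSetRing_levelSets.union_mem hA hB)) |>.exists
      rw [← h1, ← h2, ← h3, ← Finset.sum_add_distrib]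
      refine Finset.sum_congr rfl fun l _ => ?_
      by_cases hA' : x l ∈ A
      · have : x l ∉ B := fun h => Set.disjoint_left.1 hAB hA' h
        simp [hA', this]
      · simp [hA'])
  have hm : ∀ A, m A = m₀ A := fun A => rfl
  have hsub : m.IsSigmaSubadditive := by
    intro f hf' hU
    have := compactSpace hf
    have hc : IsCompact (⋃ i, f i) := by
      refine IsClosed.isCompact ⟨isOpen_of_mem_levelSets (compl_mem_levelSets hU)⟩
    obtain ⟨t, ht⟩ := hc.elim_finite_subcover f (fun i => isOpen_of_mem_levelSets (hf' i))
      subset_rfl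
    refine le_trans ?_ (ENNReal.sum_le_tsum t)
    have h1 : ∀ᶠ n in atTop, ∀ i ∈ t, a n (f i) = m₀ (f i) :=
      (Filter.eventually_all_finset t).2 fun i _ => hev _ (hf' i)
    obtain ⟨n, h2, h3⟩ := (h1.and (hev _ hU)).exists
    simp only [hm]
    rw [← h3, ← Finset.sum_congr rfl h2, Finset.sum_comm]
    refine Finset.sum_le_sum fun l _ => ?_
    split_ifs with h
    · obtain ⟨i, hi, hxi⟩ := mem_iUnion₂.1 (ht h)
      refine le_trans ?_ (Finset.single_le_sum (fun _ _ => zero_le) hi)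
      rw [if_pos hxi]
    · exact zero_le
  refine ⟨m.measure isSetRing_levelSets.isSetSemiring borel_eq_levelSets.le hsub, fun l => ?_⟩
  rw [m.measure_eq isSetRing_levelSets.isSetSemiring borel_eq_levelSets hsub
    (cyl_mem_levelSets l), hm]
  obtain ⟨n, h1, h2⟩ := ((hev _ (cyl_mem_levelSets l)).and
    (eventually_ge_atTop (Λ.deg l))).exists
  rw [← h1, S.weight_eq_sum hf ξ l h2]
  simp only [a]
  rw [← Finset.sum_filter]
  refine Finset.sum_congr ?_ fun _ _ => rfl
  ext m
  simp only [Finset.mem_filter, Finite.mem_toFinset, mem_ofPred_eq, mem_exts,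
    and_congr_right_iff]
  intro hm'
  rw [mem_cyl_iff h2, ← hm', hxs]

/-- The Borel measure `μ` associated to the representation and the vector `ξ`, determined by
`μ(Z(l)) = ⟨ξ, t_l t_l^* ξ⟩` for all `l`. -/
noncomputable def measure (S : Λ.CKFamily H) (hf : Λ.IsFinite) (hs : Λ.SourceFree) (ξ : H) :
    Measure Λ.InfinitePath :=
  (S.exists_measure hf hs ξ).choose

theorem measure_cyl (S : Λ.CKFamily H) (hf : Λ.IsFinite) (hs : Λ.SourceFree) (ξ : H) (l : Λ.Mor) :
    S.measure hf hs ξ (Λ.cyl l) = S.weight ξ l :=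
  (S.exists_measure hf hs ξ).choose_spec l

theorem eq_biUnion_of_level (hf : Λ.IsFinite) {A : Set Λ.InfinitePath} {n : Fin k → ℕ}
    (hA : ∀ x y : Λ.InfinitePath, x.seg n = y.seg n → (x ∈ A ↔ y ∈ A)) :
    ∃ F : Finset Λ.Mor, (∀ l ∈ F, Λ.deg l = n) ∧ A = ⋃ l ∈ F, Λ.cyl l := by
  classical
  refine ⟨(hf n).toFinset.filter fun l => ∃ x ∈ A, x.seg n = l, ?_, ?_⟩
  · intro l hl
    simp only [Finset.mem_filter, Finite.mem_toFinset] at hl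
    exact hl.1
  · ext x
    simp only [mem_iUnion, Finset.mem_filter, Finite.mem_toFinset, mem_ofPred_eq, exists_prop]
    constructor
    · intro hx
      exact ⟨x.seg n, ⟨x.deg_seg n, x, hx, rfl⟩, by simp only [cyl, mem_ofPred_eq, x.deg_seg]⟩
    · rintro ⟨l, ⟨hl, y, hy, hyl⟩, hx⟩
      refine (hA y x ?_).1 hy
      simp only [cyl, mem_ofPred_eq, hl] at hx
      rw [hyl, hx]

theorem pairwiseDisjoint_cyl {F : Finset Λ.Mor} {n : Fin k → ℕ} (hF : ∀ l ∈ F, Λ.deg l = n) :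
    (F : Set Λ.Mor).PairwiseDisjoint Λ.cyl := by
  intro l hl m hm hne
  refine Set.disjoint_left.2 fun x hx hx' => hne ?_
  have h1 : x.seg (Λ.deg l) = l := hx
  have h2 : x.seg (Λ.deg m) = m := hx'
  rw [← h1, ← h2, hF l hl, hF m hm]

theorem isFiniteMeasure_of_cyl (hf : Λ.IsFinite) {μ : Measure Λ.InfinitePath}
    (h : ∀ l, μ (Λ.cyl l) ≠ ∞) : IsFiniteMeasure μ := by
  obtain ⟨F, hF, hU⟩ := eq_biUnion_of_level hf (A := univ) (n := 0) (by simp)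
  refine ⟨?_⟩
  rw [hU]
  refine (measure_biUnion_finset_le F _).trans_lt ?_
  exact ENNReal.sum_lt_top.2 fun l _ => (h l).lt_top

instance (S : Λ.CKFamily H) (hf : Λ.IsFinite) (hs : Λ.SourceFree) (ξ : H) :
    IsFiniteMeasure (S.measure hf hs ξ) :=
  isFiniteMeasure_of_cyl hf fun l => by
    rw [S.measure_cyl, weight]
    exact ENNReal.ofReal_ne_top

/-- The measure is determined by its values on cylinder sets. -/
theorem measure_unique (S : Λ.CKFamily H) (hf : Λ.IsFinite) (hs : Λ.SourceFree) (ξ : H)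
    (ν : Measure Λ.InfinitePath) (hν : ∀ l, ν (Λ.cyl l) = S.weight ξ l) :
    ν = S.measure hf hs ξ := by
  have hν' : IsFiniteMeasure ν := isFiniteMeasure_of_cyl hf fun l => by
    rw [hν, weight]
    exact ENNReal.ofReal_ne_top
  have key : ∀ A ∈ Λ.LevelSets, ν A = S.measure hf hs ξ A := by
    rintro A ⟨n, hA⟩
    obtain ⟨F, hF, rfl⟩ := eq_biUnion_of_level hf hA
    rw [measure_biUnion_finset (pairwiseDisjoint_cyl hF) fun l _ => measurableSet_cyl l,
      measure_biUnion_finset (pairwiseDisjoint_cyl hF) fun l _ => measurableSet_cyl l]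
    exact Finset.sum_congr rfl fun l _ => by rw [hν, measure_cyl]
  refine ext_of_generate_finite _ borel_eq_levelSets ?_ key (key _ ⟨0, by simp⟩)
  exact fun A hA B hB _ => isSetRing_levelSets.inter_mem hA hB

/-- The indicator function of the cylinder set `Z(l)` as an element of `L²(μ)`. -/
noncomputable def cylFun (μ : Measure Λ.InfinitePath) [IsFiniteMeasure μ] (l : Λ.Mor) :
    Lp ℂ 2 μ :=
  indicatorConstLp 2 (measurableSet_cyl l) (measure_ne_top μ _) (1 : ℂ)

theorem span_cylFun_dense (hf : Λ.IsFinite) (μ : Measure Λ.InfinitePath) [IsFiniteMeasure μ] :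
    (Submodule.span ℂ (range (cylFun μ))).topologicalClosure = ⊤ := by
  rw [Submodule.topologicalClosure_eq_top_iff, Submodule.eq_bot_iff]
  intro g hg
  have hint : Integrable g μ := (Lp.memLp g).integrable (by norm_num)
  have hc : ∀ l, ∫ x in Λ.cyl l, g x ∂μ = 0 := by
    intro l
    rw [← L2.inner_indicatorConstLp_one (𝕜 := ℂ) (measurableSet_cyl l) (measure_ne_top μ _) g]
    exact (Submodule.mem_orthogonal _ _).1 hg _ (Submodule.subset_span ⟨l, rfl⟩)
  have hl : ∀ A ∈ Λ.LevelSets, ∫ x in A, g x ∂μ = 0 := by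
    rintro A ⟨n, hA⟩
    obtain ⟨F, hF, rfl⟩ := eq_biUnion_of_level hf hA
    rw [integral_biUnion_finset F (fun l _ => measurableSet_cyl l) (pairwiseDisjoint_cyl hF)
      fun l _ => hint.integrableOn]
    exact Finset.sum_eq_zero fun l _ => hc l
  have hall : ∀ A, MeasurableSet A → ∫ x in A, g x ∂μ = 0 := by
    intro A hA
    induction A, hA using MeasurableSpace.induction_on_inter borel_eq_levelSets
      (fun A hA B hB _ => isSetRing_levelSets.inter_mem hA hB) with
    | empty => simp
    | basic A hA => exact hl A hA
    | compl A hA ih =>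
      have h1 := integral_add_compl hA hint
      rw [ih, zero_add] at h1
      rw [h1, ← setIntegral_univ]
      exact hl _ ⟨0, by simp⟩
    | iUnion f hd hm ih =>
      rw [integral_iUnion hm hd hint.integrableOn]
      simp [ih]
  have h0 := hint.ae_eq_zero_of_forall_setIntegral_eq_zero fun A hA _ => hall A hA
  exact (Lp.eq_zero_iff_ae_eq_zero).2 h0

/-- `ξ` is a cyclic vector for the restriction of the representation to the diagonal subalgebra:
the closed linear span of the vectors `t_l t_l^* ξ` is `H`. -/
def IsCyclicVector (S : Λ.CKFamily H) (ξ : H) : Prop :=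
  (Submodule.span ℂ (range fun l => S.t l (star (S.t l) ξ))).topologicalClosure = ⊤

/-- The representation is monic. -/
def IsMonic (S : Λ.CKFamily H) : Prop :=
  (∀ l, S.t l ≠ 0) ∧ ∃ ξ, S.IsCyclicVector ξ

theorem inner_cylFun (S : Λ.CKFamily H) (hf : Λ.IsFinite) (hs : Λ.SourceFree) (ξ : H)
    (l m : Λ.Mor) :
    ⟪cylFun (S.measure hf hs ξ) l, cylFun (S.measure hf hs ξ) m⟫_ℂ
      = ⟪S.proj l ξ, S.proj m ξ⟫_ℂ := by
  classical
  have hU : Λ.cyl m ∩ Λ.cyl l = ⋃ i ∈ exts hf l (Λ.deg l ⊔ Λ.deg m) ∩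
      exts hf m (Λ.deg l ⊔ Λ.deg m), Λ.cyl i := by
    ext x
    rw [mem_inter_iff, mem_cyl_iff (x := x) (l := l) le_sup_left,
      mem_cyl_iff (x := x) (l := m) le_sup_right]
    simp only [mem_iUnion, Finset.mem_inter, mem_exts, exists_prop]
    constructor
    · rintro ⟨h1, h2⟩
      exact ⟨_, ⟨⟨x.deg_seg _, h2⟩, x.deg_seg _, h1⟩, by simp only [cyl, mem_ofPred_eq, x.deg_seg]⟩
    · rintro ⟨i, ⟨⟨h1, h2⟩, -, h3⟩, hx⟩
      simp only [cyl, mem_ofPred_eq, h1] at hx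
      rw [hx]
      exact ⟨h3, h2⟩
  rw [S.inner_proj_proj hf, cylFun, L2.inner_indicatorConstLp_one, cylFun,
    setIntegral_indicatorConstLp (measurableSet_cyl l), hU, Measure.real,
    measure_biUnion_finset (pairwiseDisjoint_cyl fun i hi =>
      (mem_exts.1 (Finset.mem_inter.1 hi).1).1) fun l _ => measurableSet_cyl l,
    Finset.sum_congr rfl fun i _ => (S.measure_cyl hf hs ξ i).trans (S.weight_eq ξ i),
    ← ENNReal.ofReal_sum_of_nonneg (fun _ _ => sq_nonneg _),
    ENNReal.toReal_ofReal (Finset.sum_nonneg fun _ _ => sq_nonneg _), Complex.real_smul, mul_one]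

/-- Existence of the unitary `W : L²(μ) → H` with `W(χ_{Z(l)}) = t_l t_l^* ξ` for all `l`. -/
theorem exists_unitary (S : Λ.CKFamily H) (hf : Λ.IsFinite) (hs : Λ.SourceFree) (ξ : H)
    (hξ : S.IsCyclicVector ξ) : ∃ W : Lp ℂ 2 (S.measure hf hs ξ) ≃ₗᵢ[ℂ] H,
      ∀ l, W (cylFun _ l) = S.t l (star (S.t l) ξ) := by
  set a := cylFun (S.measure hf hs ξ) with ha
  set b : Λ.Mor → H := fun l => S.t l (star (S.t l) ξ) with hb
  let e₁ := Finsupp.linearCombination ℂ a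
  let e₂ := Finsupp.linearCombination ℂ b
  have hd₁ : DenseRange e₁ := by
    have h := span_cylFun_dense hf (S.measure hf hs ξ)
    rw [← Finsupp.range_linearCombination] at h
    exact (Submodule.dense_iff_topologicalClosure_eq_top).2 h
  have hd₂ : DenseRange e₂ := by
    have h : (Submodule.span ℂ (range b)).topologicalClosure = ⊤ := hξ
    rw [← Finsupp.range_linearCombination] at h
    exact (Submodule.dense_iff_topologicalClosure_eq_top).2 h
  have hg : ∀ l m, ⟪a l, a m⟫_ℂ = ⟪b l, b m⟫_ℂ := S.inner_cylFun hf hs ξ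
  have hn : ∀ x, ‖e₂ (LinearEquiv.refl ℂ _ x)‖ = ‖e₁ x‖ := by
    intro x
    have h1 : ⟪e₂ x, e₂ x⟫_ℂ = ⟪e₁ x, e₁ x⟫_ℂ := by
      simp only [e₁, e₂, Finsupp.linearCombination_apply, Finsupp.sum, sum_inner, inner_sum,
        inner_smul_left, inner_smul_right, hg]
    rw [LinearEquiv.refl_apply, @norm_eq_sqrt_re_inner ℂ, h1, ← @norm_eq_sqrt_re_inner ℂ]
  refine ⟨(LinearEquiv.refl ℂ (Λ.Mor →₀ ℂ)).extendOfIsometry e₁ e₂ hd₁ hd₂ hn, fun l => ?_⟩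
  have h1 : a l = e₁ (Finsupp.single l 1) := by simp [e₁]
  have h2 : b l = e₂ (Finsupp.single l 1) := by simp [e₂]
  rw [h1]
  change _ = b l
  rw [h2]
  exact LinearEquiv.extendOfIsometry_eq _ e₁ e₂ hd₁ hd₂ hn _

/-- The unitary `W : L²(μ) → H` determined by `W(χ_{Z(l)}) = t_l t_l^* ξ` for all `l`. -/
noncomputable def unitary (S : Λ.CKFamily H) (hf : Λ.IsFinite) (hs : Λ.SourceFree) (ξ : H)
    (hξ : S.IsCyclicVector ξ) : Lp ℂ 2 (S.measure hf hs ξ) ≃ₗᵢ[ℂ] H :=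
  (S.exists_unitary hf hs ξ hξ).choose

theorem unitary_cylFun (S : Λ.CKFamily H) (hf : Λ.IsFinite) (hs : Λ.SourceFree) (ξ : H)
    (hξ : S.IsCyclicVector ξ) (l : Λ.Mor) :
    S.unitary hf hs ξ hξ (cylFun _ l) = S.t l (star (S.t l) ξ) :=
  (S.exists_unitary hf hs ξ hξ).choose_spec l

/-- The unitary is determined by its values on the indicator functions of cylinder sets. -/
theorem unitary_unique (S : Λ.CKFamily H) (hf : Λ.IsFinite) (hs : Λ.SourceFree) (ξ : H)
    (hξ : S.IsCyclicVector ξ) (W : Lp ℂ 2 (S.measure hf hs ξ) ≃ₗᵢ[ℂ] H)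
    (hW : ∀ l, W (cylFun _ l) = S.t l (star (S.t l) ξ)) : W = S.unitary hf hs ξ hξ := by
  have h := ContinuousLinearMap.ext_on
    (Submodule.dense_iff_topologicalClosure_eq_top.2 (span_cylFun_dense hf (S.measure hf hs ξ)))
    (f := (W.toContinuousLinearEquiv : _ →L[ℂ] H))
    (g := ((S.unitary hf hs ξ hξ).toContinuousLinearEquiv : _ →L[ℂ] H))
    (by
      rintro _ ⟨l, rfl⟩
      exact (hW l).trans (S.unitary_cylFun hf hs ξ hξ l).symm)
  exact LinearIsometryEquiv.ext fun x => DFunLike.congr_fun h x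

/-- The function `f_l = W^* t_l ξ ∈ L²(μ)` of the `Λ`-projective system associated to the monic
representation. -/
noncomputable def projFun (S : Λ.CKFamily H) (hf : Λ.IsFinite) (hs : Λ.SourceFree) (ξ : H)
    (hξ : S.IsCyclicVector ξ) (l : Λ.Mor) : Lp ℂ 2 (S.measure hf hs ξ) :=
  (S.unitary hf hs ξ hξ).symm (S.t l ξ)

/-- Unitary equivalence of representations. -/
def UnitarilyEquivalent {K : Type*} [NormedAddCommGroup K] [InnerProductSpace ℂ K]
    [CompleteSpace K] (S : Λ.CKFamily H) (T : Λ.CKFamily K) : Prop :=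
  ∃ U : H ≃ₗᵢ[ℂ] K, ∀ l x, U (S.t l x) = T.t l (U x)

end CKFamily

end KGraph

/-! Through its cyclic vector, a monic representation becomes a system of weighted composition
operators on $L^2(\mu)$. The unitary $W$ turns $t_\lambda t_\lambda^*$ into multiplication by
$\chi_{Z(\lambda)}$ (`conj_proj`) and $t_\lambda$ into $F \mapsto f_\lambda \cdot
(F\circ\sigma^{d(\lambda)})$ (`conj_t`). Both are checked on cylinder indicators, whose span is
dense, and extended by boundedness (`coeFn_apply_of_cylFun`). The weighted composition operator is
well defined and bounded because the image of $|f_\lambda|^2\mu$ under $\sigma^{d(\lambda)}$ is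
$\mu$ restricted to $Z(s(\lambda))$ (`map_shift_withDensity_projFun`).

If $U$ intertwines $S$ and $T$, then $W_T^*UW_S$ commutes with multiplication by cylinder
indicators, so it is multiplication by $h = W_T^*U\xi$, and comparing norms on cylinders gives
$\mu_S = |h|^2\mu_T$ (`exists_multiplier`). Computing $W_T^*US_\lambda\xi = W_T^*T_\lambda U\xi$ in
two ways gives $h f^S_\lambda = (h\circ\sigma^n) f^T_\lambda$, and $h \ne 0$ holds $\mu_S$-almost
everywhere.

Conversely, $\mu_S = |h|^2\mu_T$ together with $\mu_T \ll \mu_S$ makes multiplication by $h$ a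
unitary from $L^2(\mu_S)$ onto $L^2(\mu_T)$. The relation between $f^S_\lambda$ and $f^T_\lambda$ is
exactly what makes it intertwine the two weighted composition models
(`unitarilyEquivalent_of_function`). -/

/-! ### Weighted composition operators between L² spaces -/

section WeightedComp

variable {X Y : Type*} [MeasurableSpace X] [MeasurableSpace Y] {μ : Measure Y} {ν : Measure X}
  {w : X → ℂ} {τ : X → Y}

/-- The map τ may pull a μ-null set back to a set of positive ν-measure. By `hle` such a set is null
for |w|²ν, so up to a ν-null set it lies where w vanishes, and there both sides are zero. -/
theorem ae_eq_mul_comp (hw : Measurable w) (hτ : Measurable τ)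
    (hle : (ν.withDensity fun x => ‖w x‖ₑ ^ 2).map τ ≤ μ) {F G : Y → ℂ} (h : F =ᵐ[μ] G) :
    (fun x => w x * F (τ x)) =ᵐ[ν] fun x => w x * G (τ x) := by
  have h1 := ae_of_ae_map hτ.aemeasurable (h.filter_mono (ae_mono hle))
  rw [ae_withDensity_iff (by fun_prop)] at h1
  filter_upwards [h1] with x hx
  by_cases h0 : w x = 0
  · simp [h0]
  · rw [hx (by simpa using h0)]

theorem lintegral_enorm_mul_comp (hw : Measurable w) (hτ : Measurable τ) {F : Y → ℂ}
    (hF : Measurable F) :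
    ∫⁻ x, ‖w x * F (τ x)‖ₑ ^ 2 ∂ν
      = ∫⁻ y, ‖F y‖ₑ ^ 2 ∂((ν.withDensity fun x => ‖w x‖ₑ ^ 2).map τ) := by
  rw [lintegral_map (by fun_prop) hτ, lintegral_withDensity_eq_lintegral_mul _ (by fun_prop)
    (by fun_prop)]
  simp [mul_pow]

theorem eLpNorm_two_eq (F : X → ℂ) :
    eLpNorm F 2 ν = (∫⁻ x, ‖F x‖ₑ ^ 2 ∂ν) ^ (1 / 2 : ℝ) := by
  rw [eLpNorm_eq_lintegral_rpow_enorm_toReal (by norm_num) (by norm_num)]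
  simp

theorem eLpNorm_mul_comp_le (hw : Measurable w) (hτ : Measurable τ)
    (hle : (ν.withDensity fun x => ‖w x‖ₑ ^ 2).map τ ≤ μ) {F : Y → ℂ} (hF : Measurable F) :
    eLpNorm (fun x => w x * F (τ x)) 2 ν ≤ eLpNorm F 2 μ := by
  rw [eLpNorm_two_eq, eLpNorm_two_eq, lintegral_enorm_mul_comp hw hτ hF]
  gcongr

theorem memLp_mul_comp (hw : Measurable w) (hτ : Measurable τ)
    (hle : (ν.withDensity fun x => ‖w x‖ₑ ^ 2).map τ ≤ μ) (F : Lp ℂ 2 μ) :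
    MemLp (fun x => w x * F (τ x)) 2 ν := by
  have hF : Measurable F := (Lp.stronglyMeasurable F).measurable
  exact ⟨(hw.mul (hF.comp hτ)).aestronglyMeasurable,
    (eLpNorm_mul_comp_le hw hτ hle hF).trans_lt (Lp.memLp F).2⟩

/-- The weighted composition operator `F ↦ w · (F ∘ τ)` from `L²(μ)` to `L²(ν)`, where the image
under `τ` of the measure `|w|² ν` is at most `μ`. -/
noncomputable def weightedComp (hw : Measurable w) (hτ : Measurable τ)
    (hle : (ν.withDensity fun x => ‖w x‖ₑ ^ 2).map τ ≤ μ) : Lp ℂ 2 μ →L[ℂ] Lp ℂ 2 ν :=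
  LinearMap.mkContinuous
    { toFun := fun F => (memLp_mul_comp hw hτ hle F).toLp
      map_add' := fun F G => by
        rw [← MemLp.toLp_add]
        refine MemLp.toLp_congr _ _ ((ae_eq_mul_comp hw hτ hle (Lp.coeFn_add F G)).trans ?_)
        exact .of_forall fun x => by simp [mul_add]
      map_smul' := fun c F => by
        rw [RingHom.id_apply, ← MemLp.toLp_const_smul]
        refine MemLp.toLp_congr _ _ ((ae_eq_mul_comp hw hτ hle (Lp.coeFn_smul c F)).trans ?_)
        exact .of_forall fun x => by simp [mul_left_comm] }
    1 fun F => by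
      rw [one_mul, LinearMap.coe_mk, AddHom.coe_mk, Lp.norm_toLp, Lp.norm_def]
      exact ENNReal.toReal_mono (Lp.memLp F).2.ne
        (eLpNorm_mul_comp_le hw hτ hle (Lp.stronglyMeasurable F).measurable)

theorem coeFn_weightedComp (hw : Measurable w) (hτ : Measurable τ)
    (hle : (ν.withDensity fun x => ‖w x‖ₑ ^ 2).map τ ≤ μ) (F : Lp ℂ 2 μ) :
    weightedComp hw hτ hle F =ᵐ[ν] fun x => w x * F (τ x) :=
  MemLp.coeFn_toLp (memLp_mul_comp hw hτ hle F)

/-- Change of variables: equality of the image measure with μ, rather than domination, makes the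
operator isometric. -/
theorem norm_weightedComp (hw : Measurable w) (hτ : Measurable τ)
    (he : (ν.withDensity fun x => ‖w x‖ₑ ^ 2).map τ = μ) (F : Lp ℂ 2 μ) :
    ‖weightedComp hw hτ he.le F‖ = ‖F‖ := by
  rw [Lp.norm_def, Lp.norm_def, eLpNorm_congr_ae (coeFn_weightedComp hw hτ he.le F),
    eLpNorm_two_eq, eLpNorm_two_eq,
    lintegral_enorm_mul_comp hw hτ (Lp.stronglyMeasurable F).measurable, he]

theorem lintegral_enorm_sq (F : Lp ℂ 2 ν) :
    ∫⁻ x, ‖F x‖ₑ ^ 2 ∂ν = ENNReal.ofReal (‖F‖ ^ 2) := by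
  rw [Lp.norm_def, ← ENNReal.toReal_pow, ENNReal.ofReal_toReal
    (ENNReal.pow_ne_top (Lp.memLp F).2.ne), eLpNorm_two_eq, ← ENNReal.rpow_natCast,
    ← ENNReal.rpow_mul]
  simp

end WeightedComp

/-! ### Shifts and cylinder sets -/

namespace KGraph

variable {k : ℕ} {Λ : KGraph.{u} k}

namespace InfinitePath

theorem map_eq_of_seg_eq {x y : Λ.InfinitePath} {p q n : Fin k → ℕ} (h : p ≤ q) (hn : q ≤ n)
    (e : x.seg n = y.seg n) : x.map p q h = y.map p q h := by
  have h1 := x.map_comp 0 p q zero_le h (by rw [x.s_map, x.r_map])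
  have h2 := y.map_comp 0 p q zero_le h (by rw [y.s_map, y.r_map])
  have h3 : x.map 0 q zero_le = y.map 0 q zero_le := seg_eq_of_le hn e
  rw [h1, h2] at h3
  exact (factor_unique _ _ h3 (by rw [x.deg_map, y.deg_map])).2

theorem measurable_shift (n : Fin k → ℕ) :
    Measurable (shift n : Λ.InfinitePath → Λ.InfinitePath) := by
  have h : @Measurable _ _ _ (MeasurableSpace.generateFrom (range Λ.cyl))
      (shift n : Λ.InfinitePath → Λ.InfinitePath) := by
    refine measurable_generateFrom ?_
    rintro _ ⟨l, rfl⟩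
    refine (isOpen_of_mem_levelSets ⟨Λ.deg l + n, fun x y h => ?_⟩).measurableSet
    -- The segment of the shifted path is by definition x(0 + n, d(l) + n), so it is determined by
    -- the initial segment of degree d(l) + n, and the preimage of a cylinder is a level set.
    have h1 : (x.shift n).seg (Λ.deg l) = (y.shift n).seg (Λ.deg l) :=
      map_eq_of_seg_eq (x := x) (y := y) (p := 0 + n) (add_le_add_left zero_le n) le_rfl h
    simp only [mem_preimage, cyl, mem_ofPred_eq, h1]
  rw [← borel_eq] at h
  exact h

theorem s_seg (x : Λ.InfinitePath) (n d : Fin k → ℕ) :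
    Λ.s (x.seg n) = Λ.r ((x.shift n).seg d) := by
  rw [seg, x.s_map, seg, (x.shift n).r_map]
  change _ = x.obj (0 + n)
  rw [zero_add]

theorem seg_add (x : Λ.InfinitePath) (n d : Fin k → ℕ) :
    x.seg (n + d) = Λ.comp (x.seg n) ((x.shift n).seg d) (x.s_seg n d) := by
  -- The endpoints n + d and d + n are made variables, because `map` depends on proofs about its
  -- endpoints and cannot be rewritten directly.
  have h : ∀ (a b : Fin k → ℕ) (hb : 0 + n ≤ b) (hab : a = b) (h' : Λ.s (x.seg n) = _),
      x.seg a = Λ.comp (x.seg n) (x.map (0 + n) b hb) h' := by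
    rintro a b hb rfl h'
    have h1 := x.map_comp 0 (0 + n) a zero_le hb (by rw [x.s_map, x.r_map])
    rw [seg, h1]
    congr 1
    simp only [zero_add]
    rfl
  exact h _ _ _ (add_comm _ _) _

end InfinitePath

theorem mem_cyl_comp {l m : Λ.Mor} (h : Λ.s l = Λ.r m) {x : Λ.InfinitePath} :
    x ∈ Λ.cyl (Λ.comp l m h) ↔ x ∈ Λ.cyl l ∧ x.shift (Λ.deg l) ∈ Λ.cyl m := by
  simp only [cyl, mem_ofPred_eq, Λ.deg_comp]
  rw [x.seg_add]
  constructor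
  · intro e
    exact factor_unique _ _ e (x.deg_seg _)
  · rintro ⟨h1, h2⟩
    congr 1

theorem s_eq_r_of_mem {l m : Λ.Mor} {x : Λ.InfinitePath} (h : x ∈ Λ.cyl l)
    (h' : x.shift (Λ.deg l) ∈ Λ.cyl m) : Λ.s l = Λ.r m := by
  have h1 := x.s_seg (Λ.deg l) (Λ.deg m)
  rwa [show x.seg (Λ.deg l) = l from h, show (x.shift (Λ.deg l)).seg (Λ.deg m) = m from h'] at h1

theorem mem_cyl_one {m : Λ.Mor} {x : Λ.InfinitePath} (hx : x ∈ Λ.cyl m) (v : Λ.Obj) :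
    x ∈ Λ.cyl (Λ.one v) ↔ Λ.r m = v := by
  rw [mem_cyl_iff (n := Λ.deg m) (by simp [Λ.deg_one]), show x.seg (Λ.deg m) = m from hx]
  constructor
  · intro h
    rw [h.r_eq, Λ.r_one]
  · rintro rfl
    exact ⟨m, Λ.s_one _, (Λ.one_comp _ _).symm⟩

/-- Finite measures that agree on cylinder sets are equal. -/
theorem measure_ext_cyl (hf : Λ.IsFinite) {μ ν : Measure Λ.InfinitePath} [IsFiniteMeasure μ]
    (h : ∀ l, μ (Λ.cyl l) = ν (Λ.cyl l)) : μ = ν := by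
  have key : ∀ A ∈ Λ.LevelSets, μ A = ν A := by
    rintro A ⟨n, hA⟩
    obtain ⟨F, hF, rfl⟩ := CKFamily.eq_biUnion_of_level hf hA
    rw [measure_biUnion_finset (CKFamily.pairwiseDisjoint_cyl hF) fun l _ => measurableSet_cyl l,
      measure_biUnion_finset (CKFamily.pairwiseDisjoint_cyl hF) fun l _ => measurableSet_cyl l]
    exact Finset.sum_congr rfl fun l _ => h l
  refine ext_of_generate_finite _ borel_eq_levelSets ?_ key (key _ ⟨0, by simp⟩)
  exact fun A hA B hB _ => isSetRing_levelSets.inter_mem hA hB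

theorem measurable_indicator_cyl (l : Λ.Mor) :
    Measurable ((Λ.cyl l).indicator fun _ => (1 : ℂ)) :=
  measurable_const.indicator (measurableSet_cyl l)

/-- This presents multiplication by a cylinder indicator as a weighted composition operator with τ =
id. -/
theorem map_id_withDensity_indicator_le (μ : Measure Λ.InfinitePath) (l : Λ.Mor) :
    (μ.withDensity fun x => ‖(Λ.cyl l).indicator (fun _ => (1 : ℂ)) x‖ₑ ^ 2).map id ≤ μ := by
  rw [Measure.map_id]
  refine (withDensity_mono (.of_forall fun x => ?_)).trans withDensity_one.le
  by_cases h : x ∈ Λ.cyl l <;> simp [h]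

/-! ### Cylinder indicators as test functions, and relations among the generators -/

namespace CKFamily

variable {H : Type*} [NormedAddCommGroup H] [InnerProductSpace ℂ H] [CompleteSpace H]

theorem coeFn_cylFun (μ : Measure Λ.InfinitePath) [IsFiniteMeasure μ] (l : Λ.Mor) :
    cylFun μ l =ᵐ[μ] (Λ.cyl l).indicator fun _ => (1 : ℂ) :=
  indicatorConstLp_coeFn

theorem ext_cylFun (hf : Λ.IsFinite) {μ : Measure Λ.InfinitePath} [IsFiniteMeasure μ]
    {E : Type*} [NormedAddCommGroup E] [NormedSpace ℂ E] {A B : Lp ℂ 2 μ →L[ℂ] E}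
    (h : ∀ l, A (cylFun μ l) = B (cylFun μ l)) : A = B :=
  ContinuousLinearMap.ext_on
    (Submodule.dense_iff_topologicalClosure_eq_top.2 (span_cylFun_dense hf μ))
    (by rintro _ ⟨l, rfl⟩; exact h l)

/-- Two bounded operators that agree on cylinder indicators agree on the closure of their span,
which is all of L²(μ). This identifies both the generators and the intertwiner. -/
theorem coeFn_apply_of_cylFun (hf : Λ.IsFinite) {μ : Measure Λ.InfinitePath} [IsFiniteMeasure μ]
    {X : Type*} [MeasurableSpace X] {ν : Measure X} {w : X → ℂ} {τ : X → Λ.InfinitePath}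
    (hw : Measurable w) (hτ : Measurable τ)
    (hle : (ν.withDensity fun x => ‖w x‖ₑ ^ 2).map τ ≤ μ) (A : Lp ℂ 2 μ →L[ℂ] Lp ℂ 2 ν)
    (h : ∀ m, A (cylFun μ m) =ᵐ[ν] fun x => w x * (Λ.cyl m).indicator (fun _ => (1 : ℂ)) (τ x))
    (F : Lp ℂ 2 μ) : A F =ᵐ[ν] fun x => w x * F (τ x) := by
  have hA : A = weightedComp hw hτ hle := ext_cylFun hf fun m =>
    Lp.ext ((h m).trans ((coeFn_weightedComp hw hτ hle (cylFun μ m)).trans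
      (ae_eq_mul_comp hw hτ hle (coeFn_cylFun μ m))).symm)
  rw [hA]
  exact coeFn_weightedComp hw hτ hle F

theorem proj_mul_t_of_pre (S : Λ.CKFamily H) {l m : Λ.Mor} (h : Pre l m) :
    S.proj l * S.t m = S.t m := by
  obtain ⟨c, h, rfl⟩ := h
  rw [← S.ck2 l c h, ← mul_assoc, proj, S.partialIsometry]

theorem proj_proj_of_pre (S : Λ.CKFamily H) {l m : Λ.Mor} (h : Pre l m) (x : H) :
    S.proj l (S.proj m x) = S.proj m x := by
  have : S.proj l * S.proj m = S.proj m := by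
    rw [show S.proj m = S.t m * star (S.t m) from rfl, ← mul_assoc, S.proj_mul_t_of_pre h]
  exact DFunLike.congr_fun this x

/-- The initial segment of m of degree d(l) differs from l, so its range projection, which dominates
that of m, is orthogonal to that of l. -/
theorem proj_proj_of_not_pre (S : Λ.CKFamily H) (hf : Λ.IsFinite) {l m : Λ.Mor}
    (hd : Λ.deg l ≤ Λ.deg m) (h : ¬ Pre l m) (x : H) : S.proj l (S.proj m x) = 0 := by
  obtain ⟨a, ha, ham⟩ := exists_pre m hd
  rw [← S.proj_proj_of_pre ham]
  exact S.proj_proj_of_ne hf ha.symm (fun e => h (e ▸ ham)) _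

theorem norm_t_apply (S : Λ.CKFamily H) (l : Λ.Mor) {x : H} (h : S.t (Λ.one (Λ.s l)) x = x) :
    ‖S.t l x‖ = ‖x‖ := by
  have h1 : ⟪S.t l x, S.t l x⟫_ℂ = ⟪x, x⟫_ℂ := by
    rw [← ContinuousLinearMap.adjoint_inner_right]
    change ⟪x, (star (S.t l) * S.t l) x⟫_ℂ = _
    rw [S.ck3, h]
  rw [@norm_eq_sqrt_re_inner ℂ, h1, ← @norm_eq_sqrt_re_inner ℂ]

theorem one_proj (S : Λ.CKFamily H) (l : Λ.Mor) (x : H) :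
    S.t (Λ.one (Λ.r l)) (S.proj l x) = S.proj l x := by
  have : S.t (Λ.one (Λ.r l)) * S.proj l = S.proj l := by rw [proj, ← mul_assoc, S.one_mul_t]
  exact DFunLike.congr_fun this x

/-- The operator form of Z(lm) = Z(l) ∩ σ^{-d(l)} Z(m); it is the source of the shift in `conj_t`.
-/
theorem t_mul_proj (S : Λ.CKFamily H) {l m : Λ.Mor} (h : Λ.s l = Λ.r m) :
    S.t l * S.proj m = S.proj (Λ.comp l m h) * S.t l := by
  have h1 : star (S.t m) * (star (S.t l) * S.t l) = star (S.t m) := by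
    rw [S.ck3, ← (S.ck1_proj _).isSelfAdjoint.star_eq, ← star_mul, h, S.one_mul_t]
  rw [proj, proj, ← S.ck2 l m h, star_mul, mul_assoc, mul_assoc, mul_assoc, h1]

theorem t_proj_of_ne (S : Λ.CKFamily H) {l m : Λ.Mor} (h : Λ.s l ≠ Λ.r m) (x : H) :
    S.t l (S.proj m x) = 0 := by
  rw [← S.one_proj, ← S.t_mul_one l]
  have h1 := DFunLike.congr_fun (S.ck1_orth _ _ h) (S.proj m x)
  have h2 := congrArg (S.t l) h1
  rwa [zero_apply, map_zero] at h2

/-! ### The L² model of a monic representation -/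

section Unitary

variable (S : Λ.CKFamily H) (hf : Λ.IsFinite) (hs : Λ.SourceFree) (ξ : H) (hξ : S.IsCyclicVector ξ)

/-- The image under W of this identity is the Cuntz–Krieger decomposition of the range projection of
l, applied to ξ. -/
theorem cylFun_eq_sum (l : Λ.Mor) {n : Fin k → ℕ} (h : Λ.deg l ≤ n) (hξ : S.IsCyclicVector ξ) :
    cylFun (S.measure hf hs ξ) l = ∑ m ∈ exts hf l n, cylFun (S.measure hf hs ξ) m := by
  apply (S.unitary hf hs ξ hξ).injective
  rw [map_sum, S.unitary_cylFun hf hs ξ hξ, Finset.sum_congr rfl fun m _ =>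
    S.unitary_cylFun hf hs ξ hξ m]
  have h1 := DFunLike.congr_fun (S.proj_eq_sum hf l h) ξ
  rwa [sum_apply] at h1

theorem unitary_symm_proj_self (l : Λ.Mor) :
    (S.unitary hf hs ξ hξ).symm (S.proj l ξ) = cylFun (S.measure hf hs ξ) l :=
  (S.unitary hf hs ξ hξ).symm_apply_eq.2 (S.unitary_cylFun hf hs ξ hξ l).symm

/-- Since d(m) ≤ d(i), the cylinder Z(i) is either contained in Z(m) or disjoint from it, and the
product of the two range projections is correspondingly that of i or zero. -/
theorem unitary_symm_proj_proj (m i : Λ.Mor) (hi : Λ.deg m ≤ Λ.deg i) :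
    (S.unitary hf hs ξ hξ).symm (S.proj m (S.proj i ξ)) =ᵐ[S.measure hf hs ξ]
      fun x => (Λ.cyl m).indicator (fun _ => (1 : ℂ)) x *
        (Λ.cyl i).indicator (fun _ => (1 : ℂ)) x := by
  by_cases h : Pre m i
  · rw [S.proj_proj_of_pre h, S.unitary_symm_proj_self]
    refine (coeFn_cylFun _ i).trans (.of_forall fun x => ?_)
    by_cases hx : x ∈ Λ.cyl i
    · have h2 : x ∈ Λ.cyl m := (mem_cyl_iff hi).2
        (by rwa [show x.seg (Λ.deg i) = i from hx])
      simp [hx, h2]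
    · simp [hx]
  · rw [S.proj_proj_of_not_pre hf hi h, map_zero]
    refine (Lp.coeFn_zero _ _ _).trans (.of_forall fun x => ?_)
    by_cases hx : x ∈ Λ.cyl i
    · have h2 : x ∉ Λ.cyl m := fun h' => h
        (by rwa [mem_cyl_iff hi, show x.seg (Λ.deg i) = i from hx] at h')
      simp [hx, h2]
    · simp [hx]

/-- The operator on `L²(μ)` that corresponds to an operator on `H`. -/
noncomputable def conj (B : H →L[ℂ] H) :
    Lp ℂ 2 (S.measure hf hs ξ) →L[ℂ] Lp ℂ 2 (S.measure hf hs ξ) :=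
  ((S.unitary hf hs ξ hξ).symm.toContinuousLinearEquiv : H →L[ℂ] _) ∘L
    B ∘L ((S.unitary hf hs ξ hξ).toContinuousLinearEquiv : _ →L[ℂ] H)

theorem conj_apply (B : H →L[ℂ] H) (F : Lp ℂ 2 (S.measure hf hs ξ)) :
    S.conj hf hs ξ hξ B F
      = (S.unitary hf hs ξ hξ).symm (B (S.unitary hf hs ξ hξ F)) := rfl

theorem conj_cylFun (B : H →L[ℂ] H) (l : Λ.Mor) :
    S.conj hf hs ξ hξ B (cylFun (S.measure hf hs ξ) l)
      = (S.unitary hf hs ξ hξ).symm (B (S.proj l ξ)) := by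
  rw [conj_apply, S.unitary_cylFun hf hs ξ hξ]
  rfl

/-- The unitary turns the range projections into multiplication by indicator functions. -/
theorem conj_proj (m : Λ.Mor) (F : Lp ℂ 2 (S.measure hf hs ξ)) :
    S.conj hf hs ξ hξ (S.proj m) F =ᵐ[S.measure hf hs ξ]
      fun x => (Λ.cyl m).indicator (fun _ => (1 : ℂ)) x * F x := by
  have hw := measurable_indicator_cyl m
  have hle := map_id_withDensity_indicator_le (S.measure hf hs ξ) m
  have hA : S.conj hf hs ξ hξ (S.proj m) = weightedComp hw measurable_id hle := by
    refine ext_cylFun hf fun l => ?_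
    -- Refining Z(l) to degree d(l) ⊔ d(m) leaves only cylinders whose degree is at least d(m).
    rw [S.cylFun_eq_sum hf hs ξ l (le_sup_left : _ ≤ Λ.deg l ⊔ Λ.deg m) hξ, map_sum, map_sum]
    refine Finset.sum_congr rfl fun i hi => ?_
    rw [conj_cylFun]
    refine Lp.ext ((S.unitary_symm_proj_proj hf hs ξ hξ m i ?_).trans
      ((coeFn_weightedComp hw measurable_id hle _).trans
        (ae_eq_mul_comp hw measurable_id hle (coeFn_cylFun _ i))).symm)
    rw [(mem_exts.1 hi).1]
    exact le_sup_right
  rw [hA]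
  exact coeFn_weightedComp hw measurable_id hle F

theorem unitary_projFun (l : Λ.Mor) :
    S.unitary hf hs ξ hξ (S.projFun hf hs ξ hξ l) = S.t l ξ :=
  LinearIsometryEquiv.apply_symm_apply _ _

/-- The function is supported in Z(l) because t_l t_l^* fixes t_l ξ. -/
theorem projFun_eq_indicator (l : Λ.Mor) :
    S.projFun hf hs ξ hξ l =ᵐ[S.measure hf hs ξ]
      fun x => (Λ.cyl l).indicator (fun _ => (1 : ℂ)) x * S.projFun hf hs ξ hξ l x := by
  have h := S.conj_proj hf hs ξ hξ l (S.projFun hf hs ξ hξ l)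
  rwa [conj_apply, S.unitary_projFun,
    show S.proj l (S.t l ξ) = S.t l ξ from
      DFunLike.congr_fun (S.proj_mul_t_of_pre (Pre.refl l)) ξ] at h

theorem measurable_projFun (l : Λ.Mor) : Measurable (S.projFun hf hs ξ hξ l) :=
  (Lp.stronglyMeasurable _).measurable

/-- For composable l and m, moving the projection past t_l turns it into multiplication by the
indicator of Z(lm). Otherwise t_l kills the projection, while no path in Z(l) is shifted into Z(m).
-/
theorem unitary_symm_t_proj (l m : Λ.Mor) :
    (S.unitary hf hs ξ hξ).symm (S.t l (S.proj m ξ)) =ᵐ[S.measure hf hs ξ]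
      fun x => S.projFun hf hs ξ hξ l x *
        (Λ.cyl m).indicator (fun _ => (1 : ℂ)) (x.shift (Λ.deg l)) := by
  have h0 := S.projFun_eq_indicator hf hs ξ hξ l
  by_cases h : Λ.s l = Λ.r m
  · have h1 := S.conj_proj hf hs ξ hξ (Λ.comp l m h) (S.projFun hf hs ξ hξ l)
    rw [show S.t l (S.proj m ξ) = S.proj (Λ.comp l m h) (S.t l ξ) from
      DFunLike.congr_fun (S.t_mul_proj h) ξ]
    rw [conj_apply, S.unitary_projFun] at h1
    filter_upwards [h0, h1] with x hx0 hx1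
    rw [hx1]
    by_cases hl : x ∈ Λ.cyl l
    · by_cases hm : x.shift (Λ.deg l) ∈ Λ.cyl m
      · simp [hm, (mem_cyl_comp h).2 ⟨hl, hm⟩]
      · simp [hm, mem_cyl_comp h]
    · rw [hx0]
      simp [hl]
  · rw [S.t_proj_of_ne h, map_zero]
    filter_upwards [h0, Lp.coeFn_zero ℂ 2 (S.measure hf hs ξ)] with x hx0 hx1
    rw [hx1, hx0]
    by_cases hl : x ∈ Λ.cyl l
    · have hm : x.shift (Λ.deg l) ∉ Λ.cyl m := fun hm => h (s_eq_r_of_mem hl hm)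
      simp [hm]
    · simp [hl]

/-- The function |G|² equals |w|² on τ⁻¹(Z(m)) and vanishes elsewhere, so cylinder masses become
squared norms of vectors. -/
theorem map_withDensity_apply_cyl {X : Type*} [MeasurableSpace X] {ν : Measure X} {w : X → ℂ}
    {τ : X → Λ.InfinitePath} (hτ : Measurable τ) (m : Λ.Mor) {G : Lp ℂ 2 ν}
    (hG : G =ᵐ[ν] fun x => w x * (Λ.cyl m).indicator (fun _ => (1 : ℂ)) (τ x)) :
    (ν.withDensity fun x => ‖w x‖ₑ ^ 2).map τ (Λ.cyl m) = ENNReal.ofReal (‖G‖ ^ 2) := by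
  rw [← lintegral_enorm_sq, Measure.map_apply hτ (measurableSet_cyl m),
    withDensity_apply _ (hτ (measurableSet_cyl m)),
    ← lintegral_indicator (hτ (measurableSet_cyl m))]
  refine lintegral_congr_ae (hG.mono fun x hx => ?_)
  simp only [hx]
  by_cases h : τ x ∈ Λ.cyl m
  · simp [h]
  · simp [h]

theorem isFiniteMeasure_withDensity_sq {X : Type*} [MeasurableSpace X] {ν : Measure X}
    (G : Lp ℂ 2 ν) : IsFiniteMeasure (ν.withDensity fun x => ‖G x‖ₑ ^ 2) :=
  isFiniteMeasure_withDensity (by rw [lintegral_enorm_sq]; exact ENNReal.ofReal_ne_top)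

/-- On Z(m) the left side has mass ‖t_l t_m t_m^* ξ‖². As t_l is isometric on the range of t_{s(l)}
and zero on its complement, this is μ(Z(m)) if s(l) = r(m) and zero otherwise. -/
theorem map_shift_withDensity_projFun (l : Λ.Mor) :
    ((S.measure hf hs ξ).withDensity fun x => ‖S.projFun hf hs ξ hξ l x‖ₑ ^ 2).map
      (InfinitePath.shift (Λ.deg l)) = (S.measure hf hs ξ).restrict (Λ.cyl (Λ.one (Λ.s l))) := by
  have := isFiniteMeasure_withDensity_sq (S.projFun hf hs ξ hξ l)
  refine measure_ext_cyl hf fun m => ?_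
  rw [map_withDensity_apply_cyl (InfinitePath.measurable_shift _) m
    (S.unitary_symm_t_proj hf hs ξ hξ l m), LinearIsometryEquiv.norm_map,
    Measure.restrict_apply (measurableSet_cyl m)]
  by_cases h : Λ.s l = Λ.r m
  · have h1 : Λ.cyl m ∩ Λ.cyl (Λ.one (Λ.s l)) = Λ.cyl m :=
      inter_eq_left.2 fun x hx => (mem_cyl_one hx _).2 h.symm
    rw [h1, S.measure_cyl, S.weight_eq, S.norm_t_apply l (by rw [h, S.one_proj])]
  · have h1 : Λ.cyl m ∩ Λ.cyl (Λ.one (Λ.s l)) = ∅ :=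
      eq_empty_of_forall_notMem fun x hx => h ((mem_cyl_one hx.1 _).1 hx.2).symm
    rw [h1, S.t_proj_of_ne h]
    simp

theorem map_shift_withDensity_projFun_le (l : Λ.Mor) :
    ((S.measure hf hs ξ).withDensity fun x => ‖S.projFun hf hs ξ hξ l x‖ₑ ^ 2).map
      (InfinitePath.shift (Λ.deg l)) ≤ S.measure hf hs ξ :=
  (S.map_shift_withDensity_projFun hf hs ξ hξ l).trans_le Measure.restrict_le_self

/-- The unitary turns the generators into weighted composition operators. -/
theorem conj_t (l : Λ.Mor) (F : Lp ℂ 2 (S.measure hf hs ξ)) :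
    S.conj hf hs ξ hξ (S.t l) F =ᵐ[S.measure hf hs ξ]
      fun x => S.projFun hf hs ξ hξ l x * F (x.shift (Λ.deg l)) := by
  refine coeFn_apply_of_cylFun hf (S.measurable_projFun hf hs ξ hξ l)
    (InfinitePath.measurable_shift _) (S.map_shift_withDensity_projFun_le hf hs ξ hξ l) _
    (fun m => ?_) F
  rw [conj_cylFun]
  exact S.unitary_symm_t_proj hf hs ξ hξ l m

end Unitary

/-! ### Intertwining unitaries and multiplication operators -/

variable {K : Type*} [NormedAddCommGroup K] [InnerProductSpace ℂ K] [CompleteSpace K]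

/-- A unitary that intertwines the generators also intertwines their adjoints. -/
theorem map_proj_of_intertwines (S : Λ.CKFamily H) (T : Λ.CKFamily K) (U : H ≃ₗᵢ[ℂ] K)
    (hU : ∀ l x, U (S.t l x) = T.t l (U x)) (l : Λ.Mor) (x : H) :
    U (S.proj l x) = T.proj l (U x) := by
  have h1 : U (star (S.t l) x) = star (T.t l) (U x) := by
    refine ext_inner_right ℂ fun z => ?_
    obtain ⟨y, rfl⟩ := U.surjective z
    rw [U.inner_map_map]
    refine (ContinuousLinearMap.adjoint_inner_left _ _ _).trans ?_
    refine Eq.trans ?_ (ContinuousLinearMap.adjoint_inner_left _ _ _).symm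
    rw [← hU, U.inner_map_map]
  change U (S.t l (star (S.t l) x)) = T.t l (star (T.t l) (U x))
  rw [hU, h1]

/-- A unitary that intertwines two monic representations becomes multiplication by a function. -/
theorem exists_multiplier (S : Λ.CKFamily H) (T : Λ.CKFamily K) (hf : Λ.IsFinite)
    (hs : Λ.SourceFree) {ξ : H} (hξ : S.IsCyclicVector ξ) {η : K} (hη : T.IsCyclicVector η)
    (U : H ≃ₗᵢ[ℂ] K) (hU : ∀ l x, U (S.t l x) = T.t l (U x)) :
    ∃ h : Lp ℂ 2 (T.measure hf hs η), T.unitary hf hs η hη h = U ξ ∧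
      (T.measure hf hs η).withDensity (fun x => ‖h x‖ₑ ^ 2) = S.measure hf hs ξ ∧
      ∀ F, (T.unitary hf hs η hη).symm (U (S.unitary hf hs ξ hξ F)) =ᵐ[T.measure hf hs η]
        fun x => h x * F x := by
  set μ := S.measure hf hs ξ with hμ
  set ν := T.measure hf hs η
  set V := S.unitary hf hs ξ hξ with hV
  set W := T.unitary hf hs η hη
  set h : Lp ℂ 2 ν := W.symm (U ξ) with hh
  have hWh : W h = U ξ := W.apply_symm_apply _
  have hm : Measurable h := (Lp.stronglyMeasurable h).measurable
  have hproj : ∀ m, W.symm (U (S.proj m ξ)) =ᵐ[ν]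
      fun x => h x * (Λ.cyl m).indicator (fun _ => (1 : ℂ)) (id x) := by
    intro m
    have h1 := T.conj_proj hf hs η hη m h
    rw [conj_apply, hWh, ← S.map_proj_of_intertwines T U hU] at h1
    exact h1.trans (.of_forall fun x => mul_comm _ _)
  have := isFiniteMeasure_withDensity_sq h
  -- Both measures give Z(m) the mass ‖S_m S_m^* ξ‖², since U and W preserve norms.
  have he : (ν.withDensity fun x => ‖h x‖ₑ ^ 2).map id = μ := by
    refine measure_ext_cyl hf fun m => ?_
    rw [map_withDensity_apply_cyl measurable_id m (hproj m), W.symm.norm_map, U.norm_map, hμ,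
      S.measure_cyl, S.weight_eq]
  refine ⟨h, hWh, by rwa [Measure.map_id] at he, ?_⟩
  let A : Lp ℂ 2 μ →L[ℂ] Lp ℂ 2 ν := (W.symm.toContinuousLinearEquiv : K →L[ℂ] _) ∘L
    (U.toContinuousLinearEquiv : H →L[ℂ] K) ∘L (V.toContinuousLinearEquiv : _ →L[ℂ] H)
  refine coeFn_apply_of_cylFun hf hm measurable_id he.le A fun m => ?_
  have h1 : A (cylFun μ m) = W.symm (U (S.proj m ξ)) :=
    congrArg (fun y => W.symm (U y)) (S.unitary_cylFun hf hs ξ hξ m)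
  rw [h1]
  exact hproj m

theorem exists_function_of_intertwines (S : Λ.CKFamily H) (T : Λ.CKFamily K) (hf : Λ.IsFinite)
    (hs : Λ.SourceFree) {ξ : H} (hξ : S.IsCyclicVector ξ) {η : K} (hη : T.IsCyclicVector η)
    (U : H ≃ₗᵢ[ℂ] K) (hU : ∀ l x, U (S.t l x) = T.t l (U x)) :
    S.measure hf hs ξ ≪ T.measure hf hs η ∧
      ∃ h : Λ.InfinitePath → ℂ, Measurable h ∧
        (∀ᵐ x ∂(T.measure hf hs η),
          (S.measure hf hs ξ).rnDeriv (T.measure hf hs η) x = ENNReal.ofReal (‖h x‖ ^ 2)) ∧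
        ∀ l : Λ.Mor, ∀ᵐ x ∂(S.measure hf hs ξ),
          S.projFun hf hs ξ hξ l x
            = h (x.shift (Λ.deg l)) / h x * T.projFun hf hs η hη l x := by
  obtain ⟨h, hWh, he, hmul⟩ := S.exists_multiplier T hf hs hξ hη U hU
  have hm : Measurable h := (Lp.stronglyMeasurable h).measurable
  have hac : S.measure hf hs ξ ≪ T.measure hf hs η := he ▸ withDensity_absolutelyContinuous _ _
  refine ⟨hac, h, hm, ?_, fun l => ?_⟩
  · have h1 := Measure.rnDeriv_withDensity (T.measure hf hs η)
      (f := fun x => ‖h x‖ₑ ^ 2) (by fun_prop)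
    rw [he] at h1
    filter_upwards [h1] with x hx
    rw [hx, ENNReal.ofReal_pow (norm_nonneg _), ofReal_norm]
  · have h0 : ∀ᵐ x ∂(S.measure hf hs ξ), h x ≠ 0 := by
      rw [← he, ae_withDensity_iff (by fun_prop)]
      exact .of_forall fun x hx => by simpa using hx
    -- The vector U S_l ξ = T_l U ξ is computed in L²(μ_T) twice: as h times the S-function of l,
    -- and through `conj_t` applied to h.
    have h1 := hmul (S.projFun hf hs ξ hξ l)
    have h2 := T.conj_t hf hs η hη l h
    rw [conj_apply, hWh, ← hU] at h2
    rw [S.unitary_projFun] at h1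
    filter_upwards [h0, hac.ae_le h1, hac.ae_le h2] with x hx0 hx1 hx2
    rw [hx2] at hx1
    rw [div_mul_eq_mul_div, eq_div_iff hx0, mul_comm, ← hx1, mul_comm]

theorem unitarilyEquivalent_of_function (S : Λ.CKFamily H) (T : Λ.CKFamily K) (hf : Λ.IsFinite)
    (hs : Λ.SourceFree) {ξ : H} (hξ : S.IsCyclicVector ξ) {η : K} (hη : T.IsCyclicVector η)
    (hST : S.measure hf hs ξ ≪ T.measure hf hs η) (hTS : T.measure hf hs η ≪ S.measure hf hs ξ)
    {h : Λ.InfinitePath → ℂ} (hm : Measurable h)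
    (hd : ∀ᵐ x ∂(T.measure hf hs η),
      (S.measure hf hs ξ).rnDeriv (T.measure hf hs η) x = ENNReal.ofReal (‖h x‖ ^ 2))
    (hfun : ∀ l : Λ.Mor, ∀ᵐ x ∂(S.measure hf hs ξ),
      S.projFun hf hs ξ hξ l x = h (x.shift (Λ.deg l)) / h x * T.projFun hf hs η hη l x) :
    S.UnitarilyEquivalent T := by
  set μ := S.measure hf hs ξ
  set ν := T.measure hf hs η
  set V := S.unitary hf hs ξ hξ
  set W := T.unitary hf hs η hη
  have he : ν.withDensity (fun x => ‖h x‖ₑ ^ 2) = μ := by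
    rw [← Measure.withDensity_rnDeriv_eq μ ν hST]
    refine withDensity_congr_ae (hd.mono fun x hx => ?_)
    rw [hx, ENNReal.ofReal_pow (norm_nonneg _), ofReal_norm]
  have h0 : ∀ᵐ x ∂ν, h x ≠ 0 := by
    have h1 : ∀ᵐ x ∂μ, h x ≠ 0 := by
      rw [← he, ae_withDensity_iff (by fun_prop)]
      exact .of_forall fun x hx => by simpa using hx
    exact hTS.ae_le h1
  -- This makes multiplication by 1/h map L²(ν) to L²(μ). Nonvanishing of h matters, because 0⁻¹ = 0
  -- in ℂ whereas the inverse density would be ∞ there.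
  have he' : μ.withDensity (fun x => ‖(h x)⁻¹‖ₑ ^ 2) = ν := by
    rw [← withDensity_inv_same (μ := ν) (f := fun x => ‖h x‖ₑ ^ 2) (by fun_prop)
      (h0.mono fun x hx => by simpa using hx) (.of_forall fun x => by simp), he]
    refine withDensity_congr_ae (hST.ae_le (h0.mono fun x hx => ?_))
    simp only [enorm_inv hx, ENNReal.inv_pow]
  have hei : (ν.withDensity (fun x => ‖h x‖ₑ ^ 2)).map id = μ := by rwa [Measure.map_id]
  have hei' : (μ.withDensity (fun x => ‖(h x)⁻¹‖ₑ ^ 2)).map id = ν := by rwa [Measure.map_id]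
  let M := weightedComp hm measurable_id hei.le
  let M' := weightedComp hm.inv measurable_id hei'.le
  have hM : ∀ F, M F =ᵐ[ν] fun x => h x * F x := coeFn_weightedComp hm measurable_id hei.le
  have hM' : ∀ G, M' G =ᵐ[μ] fun x => (h x)⁻¹ * G x :=
    coeFn_weightedComp hm.inv measurable_id hei'.le
  have hMM' : ∀ G, M (M' G) = G := by
    intro G
    refine Lp.ext ?_
    filter_upwards [hM (M' G), hTS.ae_le (hM' G), h0] with x h1 h2 h3
    rw [h1, h2, mul_inv_cancel_left₀ h3]
  let N : Lp ℂ 2 μ ≃ₗᵢ[ℂ] Lp ℂ 2 ν := LinearIsometryEquiv.ofSurjective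
    ⟨M.toLinearMap, norm_weightedComp hm measurable_id hei⟩ fun G => ⟨M' G, hMM' G⟩
  have hN : ∀ F, N F = M F := fun F => rfl
  refine ⟨V.symm.trans (N.trans W), fun l x => ?_⟩
  obtain ⟨F, rfl⟩ := V.surjective x
  simp only [LinearIsometryEquiv.trans_apply, V.symm_apply_apply, hN]
  rw [eq_comm, ← W.symm_apply_eq, eq_comm]
  change M (S.conj hf hs ξ hξ (S.t l) F) = T.conj hf hs η hη (T.t l) (M F)
  refine Lp.ext ?_
  have h1 := hM (S.conj hf hs ξ hξ (S.t l) F)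
  have h2 := hTS.ae_le (S.conj_t hf hs ξ hξ l F)
  have h3 := T.conj_t hf hs η hη l (M F)
  -- The class M F equals h F only almost everywhere, and composing with the shift preserves this
  -- equality only after weighting by the T-function of l.
  have h4 := ae_eq_mul_comp (T.measurable_projFun hf hs η hη l)
    (InfinitePath.measurable_shift _) (T.map_shift_withDensity_projFun_le hf hs η hη l) (hM F)
  filter_upwards [h0, h1, h2, h3, h4, hTS.ae_le (hfun l)] with x x0 x1 x2 x3 x4 x5
  rw [x3, x4, x1, x2, x5]
  field_simp

end CKFamily

end KGraph

theorem mainTheorem8 {k : ℕ} (Λ : KGraph.{u} k) (hf : Λ.IsFinite) (hs : Λ.SourceFree)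
    {H K : Type*} [NormedAddCommGroup H] [InnerProductSpace ℂ H] [CompleteSpace H]
    [NormedAddCommGroup K] [InnerProductSpace ℂ K] [CompleteSpace K]
    (S : Λ.CKFamily H) (T : Λ.CKFamily K) (hS : S.IsMonic) (hT : T.IsMonic)
    (ξ : H) (hξ : S.IsCyclicVector ξ) (η : K) (hη : T.IsCyclicVector η) :
    S.UnitarilyEquivalent T ↔
      (S.measure hf hs ξ ≪ T.measure hf hs η ∧ T.measure hf hs η ≪ S.measure hf hs ξ) ∧
      ∃ h : Λ.InfinitePath → ℂ, Measurable h ∧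
        (∀ᵐ x ∂(T.measure hf hs η),
          (S.measure hf hs ξ).rnDeriv (T.measure hf hs η) x = ENNReal.ofReal (‖h x‖ ^ 2)) ∧
        ∀ l : Λ.Mor, ∀ᵐ x ∂(S.measure hf hs ξ),
          S.projFun hf hs ξ hξ l x = h (x.shift (Λ.deg l)) / h x * T.projFun hf hs η hη l x := by
  constructor
  · rintro ⟨U, hU⟩
    obtain ⟨hST, h⟩ := S.exists_function_of_intertwines T hf hs hξ hη U hU
    -- The reverse absolute continuity comes from applying the same result to the inverse unitary.
    obtain ⟨hTS, -⟩ := T.exists_function_of_intertwines S hf hs hη hξ U.symm fun l x => by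
      rw [U.symm_apply_eq, hU, U.apply_symm_apply]
    exact ⟨⟨hST, hTS⟩, h⟩
  · rintro ⟨⟨hST, hTS⟩, h, hm, hd, hfun⟩
    exact S.unitarilyEquivalent_of_function T hf hs hξ hη hST hTS hm hd hfun
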